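/- Let $d\ge 2$, let $\Omega\subset\mathbb R^d$ be a bounded domain (a nonempty bounded connected open set), and let $-\Delta^D_\Omega$ be the nonnegative self-adjoint Laplacian on $L^2(\Omega)$ with Dirichlet boundary conditions, i.e. the operator associated with the quadratic form $u\mapsto\int_\Omega|\nabla u|^2$ on $H^1_0(\Omega)$. Let $\lambda_1\le\lambda_2\le\dots$ be its eigenvalues, repeated according to multiplicity, and let $u_1,u_2,\dots$ be corresponding eigenfunctions, orthonormal in $L^2(\Omega)$; functions may be real or complex valued. Write $\|\cdot\|_2$, $\|\cdot\|_\infty$ for the norms of $L^2(\Omega)$, $L^\infty(\Omega)$ and $|\Omega|$ for the Lebesgue measure of $\Omega$. Then for every $\varphi\in H^1_0(\Omega)\cap L^\infty(\Omega)$ with $\varphi\ne 0$ and every $t>0$, the two series below converge and $$\sum_{j=1}^\infty e^{-\lambda_j t}\,\|\varphi u_j\|_2^2\;\ge\;(4\pi t)^{-d/2}\,\|\varphi\|_2^2\,\exp\!\Big(-\frac{\|\nabla\varphi\|_2^2}{\|\varphi\|_2^2}\,t\Big),$$ $$\sum_{j=1}^\infty e^{-\lambda_j t}\;\ge\;\frac{|\Omega|}{(4\pi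 t)^{d/2}}-\frac{1}{(4\pi t)^{d/2}}\cdot\frac{\|\nabla\varphi\|_2^2\,t+|\Omega|\,\|\varphi\|_\infty^2-\|\varphi\|_2^2}{\|\varphi\|_\infty^2}.$$ -/

import Mathlib

open MeasureTheory
open scoped ContDiff ENNReal

/-- `ψ ∈ C_c^∞(Ω)`: a smooth function whose support is a compact subset of `Ω`. -/
structure IsTestFunction {𝕜 : Type*} [RCLike 𝕜] {d : ℕ} (Ω : Set (EuclideanSpace ℝ (Fin d)))
    (ψ : EuclideanSpace ℝ (Fin d) → 𝕜) : Prop where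
  contDiff : ContDiff ℝ ∞ ψ
  hasCompactSupport : HasCompactSupport ψ
  tsupport_subset : tsupport ψ ⊆ Ω

/-- The classical gradient of a scalar (real or complex valued) function, as the vector of its
partial derivatives. -/
noncomputable def classicalGradient {𝕜 : Type*} [RCLike 𝕜] {d : ℕ}
    (ψ : EuclideanSpace ℝ (Fin d) → 𝕜) (x : EuclideanSpace ℝ (Fin d)) :
    EuclideanSpace 𝕜 (Fin d) :=
  WithLp.toLp 2 (fun i => fderiv ℝ ψ x (EuclideanSpace.single i (1 : ℝ)))

/-- `f ∈ H¹(Ω)` with weak gradient `∇f = G`: both are square integrable on `Ω`, and integration by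
parts holds against every test function. (Values off `Ω` are irrelevant.) -/
structure HasH1Gradient {𝕜 : Type*} [RCLike 𝕜] {d : ℕ} (Ω : Set (EuclideanSpace ℝ (Fin d)))
    (f : EuclideanSpace ℝ (Fin d) → 𝕜)
    (G : EuclideanSpace ℝ (Fin d) → EuclideanSpace 𝕜 (Fin d)) : Prop where
  memLp : MemLp f 2 (volume.restrict Ω)
  memLp_gradient : MemLp G 2 (volume.restrict Ω)
  integral_eq : ∀ ψ : EuclideanSpace ℝ (Fin d) → 𝕜, IsTestFunction Ω ψ → ∀ i : Fin d,
    ∫ x in Ω, f x * classicalGradient ψ x i = - ∫ x in Ω, G x i * ψ x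

/-- `f ∈ H¹₀(Ω)` with weak gradient `∇f = G`: `f` is in the closure of `C_c^∞(Ω)` for the
norm of `H¹(Ω)`. -/
structure HasH10Gradient {𝕜 : Type*} [RCLike 𝕜] {d : ℕ} (Ω : Set (EuclideanSpace ℝ (Fin d)))
    (f : EuclideanSpace ℝ (Fin d) → 𝕜)
    (G : EuclideanSpace ℝ (Fin d) → EuclideanSpace 𝕜 (Fin d)) : Prop
    extends HasH1Gradient Ω f G where
  mem_closure : ∀ ε : ℝ, 0 < ε → ∃ ψ : EuclideanSpace ℝ (Fin d) → 𝕜, IsTestFunction Ω ψ ∧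
    (∫ x in Ω, ‖f x - ψ x‖ ^ 2) + (∫ x in Ω, ‖G x - classicalGradient ψ x‖ ^ 2) < ε

/-- The graph of the Dirichlet Laplacian: `u` is in the domain of the nonnegative self-adjoint
operator `-Δ` on `L²(Ω)` with Dirichlet boundary conditions, and `-Δ u = f`. This is the operator
associated with the closed quadratic form `u ↦ ∫_Ω |∇u|²` with form domain `H¹₀(Ω)`. -/
def IsDirichletLaplacian {𝕜 : Type*} [RCLike 𝕜] {d : ℕ} (Ω : Set (EuclideanSpace ℝ (Fin d)))
    (u f : EuclideanSpace ℝ (Fin d) → 𝕜) : Prop :=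
  MemLp f 2 (volume.restrict Ω) ∧
  ∃ G : EuclideanSpace ℝ (Fin d) → EuclideanSpace 𝕜 (Fin d), HasH10Gradient Ω u G ∧
    ∀ (v : EuclideanSpace ℝ (Fin d) → 𝕜)
      (H : EuclideanSpace ℝ (Fin d) → EuclideanSpace 𝕜 (Fin d)), HasH10Gradient Ω v H →
      ∫ x in Ω, inner 𝕜 (H x) (G x) = ∫ x in Ω, inner 𝕜 (v x) (f x)

/-- `v` is an eigenfunction of the Dirichlet Laplacian with eigenvalue `μ`: it is nonzero in
`L²(Ω)` and `-Δ v = μ v`. -/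
structure IsDirichletEigenfunction {𝕜 : Type*} [RCLike 𝕜] {d : ℕ}
    (Ω : Set (EuclideanSpace ℝ (Fin d))) (μ : ℝ) (v : EuclideanSpace ℝ (Fin d) → 𝕜) : Prop where
  eigen : IsDirichletLaplacian Ω v (fun x => (μ : 𝕜) * v x)
  ne_zero : ¬ v =ᵐ[volume.restrict Ω] 0

/-- `lam 0 ≤ lam 1 ≤ …` are the eigenvalues of the Dirichlet Laplacian, repeated according to
multiplicity, and `u 0, u 1, …` are corresponding eigenfunctions, orthonormal in `L²(Ω)`.
That every eigenvalue is listed with its full multiplicity is the last field: no eigenfunction is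
orthogonal to all the `u j`. -/
structure IsDirichletEigenSequence {𝕜 : Type*} [RCLike 𝕜] {d : ℕ}
    (Ω : Set (EuclideanSpace ℝ (Fin d))) (lam : ℕ → ℝ)
    (u : ℕ → EuclideanSpace ℝ (Fin d) → 𝕜) : Prop where
  monotone : Monotone lam
  eigenfunction : ∀ j, IsDirichletEigenfunction Ω (lam j) (u j)
  orthonormal : ∀ i j, ∫ x in Ω, inner 𝕜 (u i x) (u j x) = if i = j then 1 else 0
  exhaustive : ∀ (μ : ℝ) (v : EuclideanSpace ℝ (Fin d) → 𝕜), IsDirichletEigenfunction Ω μ v →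
    ∃ j, ∫ x in Ω, inner 𝕜 (u j x) (v x) ≠ 0

/-! The method is that of coherent states. For a frequency `ξ`, the functions `φ cos(2π⟪·, ξ⟫)` and
`φ sin(2π⟪·, ξ⟫)` lie in `H¹₀(Ω)`. Let `p_j(ξ)` be the sum of the squares of the moduli of their
coefficients along `u_j`. The weights `p_j(ξ)` add up to `‖φ‖₂²` by Parseval, and `∑ λ_j p_j(ξ)` is
at most the total energy of the pair, `‖∇φ‖₂² + 4π²‖ξ‖²‖φ‖₂²`. The cross terms of the two energies
cancel because `cos² + sin² = 1`. Jensen's inequality for `exp` then gives a lower bound for `∑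
exp(-λ_j t) p_j(ξ)` with a Gaussian factor in `ξ` (`mul_exp_le_tsum_spectralDensity`).

On the other hand `p_j(ξ)` is also the Fourier density of `φ` times the conjugate of `u_j`
(`spectralDensity_mul_conj`), so by Plancherel its integral over `ξ` is `‖φ u_j‖₂²`. Integrating the
pointwise bound gives the first inequality. The second follows from `‖φ u_j‖₂ ≤ ‖φ‖_∞` and `exp(-x)
≥ 1 - x`.

Two facts about the spectrum are needed. Completeness of the `u_j`: the embedding `J` of `H¹₀(Ω)`
with the graph norm into `L²(Ω)` is compact (`isCompactOperator_energyEmbedding`), `J J*` is the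
inverse of `1 - Δ`, and the spectral theorem applies. Convergence of the heat trace: Jensen with the
probability density of `u_j` in frequency, whose mean energy is `λ_j`, and Bessel's inequality for
plane waves (`summable_exp_neg`).

Cosines and sines replace complex exponentials throughout, so that real and complex scalars are
treated together. -/

/-! ### Norms and inner products of `L²` as integrals. -/

section LpNorm

variable {α E : Type*} [MeasurableSpace α] [NormedAddCommGroup E] {μ : Measure α}

theorem norm_sq_toLp_eq_integral {f : α → E} (hf : MemLp f 2 μ) :
    ‖hf.toLp f‖ ^ 2 = ∫ x, ‖f x‖ ^ 2 ∂μ := by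
  have hnn : 0 ≤ ∫ x, ‖f x‖ ^ 2 ∂μ := integral_nonneg fun x => by positivity
  rw [Lp.norm_toLp, hf.eLpNorm_eq_integral_rpow_norm (by norm_num) (by norm_num),
    ENNReal.toReal_ofReal (by simp only [ENNReal.toReal_ofNat, Real.rpow_ofNat]; positivity)]
  simp only [ENNReal.toReal_ofNat, Real.rpow_ofNat]
  rw [← Real.rpow_natCast, ← Real.rpow_mul hnn]
  norm_num

theorem MeasureTheory.Lp.norm_sq_eq_integral (f : Lp E 2 μ) :
    ‖f‖ ^ 2 = ∫ x, ‖f x‖ ^ 2 ∂μ := by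
  rw [← norm_sq_toLp_eq_integral (Lp.memLp f), Lp.toLp_coeFn]

theorem inner_toLp_eq_integral {𝕜 : Type*} [RCLike 𝕜] [InnerProductSpace 𝕜 E] {f g : α → E}
    (hf : MemLp f 2 μ) (hg : MemLp g 2 μ) :
    inner 𝕜 (hf.toLp f) (hg.toLp g) = ∫ x, inner 𝕜 (f x) (g x) ∂μ := by
  rw [L2.inner_def]
  apply integral_congr_ae
  filter_upwards [hf.coeFn_toLp, hg.coeFn_toLp] with x hx hy
  rw [hx, hy]

end LpNorm

/-! ### Plancherel's theorem for the Fourier integral on `L¹ ∩ L²`. -/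

section Plancherel

open FourierTransform SchwartzMap

variable {d : ℕ}

/-- On `L¹ ∩ L²` the `L²` Fourier transform is given by the Fourier integral. -/
theorem fourier_toLp_ae_eq {h : EuclideanSpace ℝ (Fin d) → ℂ} (h2 : MemLp h 2 volume)
    (h1 : Integrable h) :
    (𝓕 (h2.toLp h) : Lp ℂ 2 (volume : Measure (EuclideanSpace ℝ (Fin d)))) =ᵐ[volume] 𝓕 h := by
  have hcont : Continuous (𝓕 h) :=
    VectorFourier.fourierIntegral_continuous Real.continuous_fourierChar
      (by exact continuous_inner) h1
  refine ae_eq_of_integral_contDiff_smul_eq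
    ((Lp.memLp _).locallyIntegrable (by norm_num)) hcont.locallyIntegrable ?_
  intro g g_smooth g_cpt
  have hg₁ : HasCompactSupport (Complex.ofRealCLM ∘ g) := g_cpt.comp_left rfl
  have hg₂ : ContDiff ℝ ∞ (Complex.ofRealCLM ∘ g) := by fun_prop
  set G : 𝓢(EuclideanSpace ℝ (Fin d), ℂ) := hg₁.toSchwartzMap hg₂
  -- The `L²` transform agrees with the distributional one, so pairing with `G` moves the transform
  -- onto `G`. The flip formula for Fourier integrals moves it back onto `h`.
  have e1 := DFunLike.congr_fun (Lp.fourier_toTemperedDistribution_eq (h2.toLp h)) G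
  rw [TemperedDistribution.fourier_apply, Lp.toTemperedDistribution_apply,
    Lp.toTemperedDistribution_apply] at e1
  have e2 : ∫ x, (𝓕 (G : EuclideanSpace ℝ (Fin d) → ℂ)) x • h x = ∫ x, G x • 𝓕 h x := by
    simpa using! (VectorFourier.integral_fourierIntegral_smul_eq_flip
      (L := innerₗ (EuclideanSpace ℝ (Fin d))) Real.continuous_fourierChar continuous_inner
      (G.integrable (μ := volume)) h1)
  have e3 : ∫ x, (𝓕 G) x • (h2.toLp h) x = ∫ x, (𝓕 (G : EuclideanSpace ℝ (Fin d) → ℂ)) x • h x := by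
    apply integral_congr_ae
    filter_upwards [h2.coeFn_toLp] with x hx
    rw [hx, SchwartzMap.fourier_coe]
  rw [e3, e2] at e1
  simpa [G] using e1.symm

theorem memLp_fourier {h : EuclideanSpace ℝ (Fin d) → ℂ} (h2 : MemLp h 2 volume)
    (h1 : Integrable h) : MemLp (𝓕 h) 2 volume :=
  (memLp_congr_ae (fourier_toLp_ae_eq h2 h1)).1 (Lp.memLp _)

/-- **Plancherel's theorem** on `L¹ ∩ L²`. -/
theorem integral_norm_sq_fourier {h : EuclideanSpace ℝ (Fin d) → ℂ} (h2 : MemLp h 2 volume)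
    (h1 : Integrable h) : ∫ ξ, ‖𝓕 h ξ‖ ^ 2 = ∫ x, ‖h x‖ ^ 2 := by
  calc ∫ ξ, ‖𝓕 h ξ‖ ^ 2 = ∫ ξ, ‖𝓕 (h2.toLp h) ξ‖ ^ 2 := by
        apply integral_congr_ae
        filter_upwards [fourier_toLp_ae_eq h2 h1] with x hx
        rw [hx]
    _ = ‖h2.toLp h‖ ^ 2 := by rw [← Lp.norm_sq_eq_integral, Lp.norm_fourier_eq]
    _ = ∫ x, ‖h x‖ ^ 2 := norm_sq_toLp_eq_integral h2

end Plancherel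

/-! ### Cosine and sine coefficients, and Plancherel for them. -/

section SpectralDensity

variable {𝕜 : Type*} [RCLike 𝕜] {d : ℕ}

/-- The plane wave `x ↦ cos (2π⟪x, ξ⟫ - θ)`. -/
noncomputable def planeWave (θ : ℝ) (ξ x : EuclideanSpace ℝ (Fin d)) : ℝ :=
  Real.cos (2 * Real.pi * inner ℝ x ξ - θ)

/-- The Fourier coefficient of `f` on `Ω` against a plane wave. -/
noncomputable def waveCoeff (Ω : Set (EuclideanSpace ℝ (Fin d)))
    (f : EuclideanSpace ℝ (Fin d) → 𝕜) (θ : ℝ) (ξ : EuclideanSpace ℝ (Fin d)) : 𝕜 :=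
  ∫ x in Ω, (planeWave θ ξ x : 𝕜) * f x

/-- The spectral density of `f` on `Ω`: the sum of the squared cosine and sine coefficients. -/
noncomputable def spectralDensity (Ω : Set (EuclideanSpace ℝ (Fin d)))
    (f : EuclideanSpace ℝ (Fin d) → 𝕜) (ξ : EuclideanSpace ℝ (Fin d)) : ℝ :=
  ‖waveCoeff Ω f 0 ξ‖ ^ 2 + ‖waveCoeff Ω f (Real.pi / 2) ξ‖ ^ 2

theorem spectralDensity_nonneg (Ω : Set (EuclideanSpace ℝ (Fin d)))
    (f : EuclideanSpace ℝ (Fin d) → 𝕜) (ξ : EuclideanSpace ℝ (Fin d)) :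
    0 ≤ spectralDensity Ω f ξ := by
  unfold spectralDensity; positivity

theorem abs_planeWave_le_one (θ : ℝ) (ξ x : EuclideanSpace ℝ (Fin d)) : |planeWave θ ξ x| ≤ 1 :=
  Real.abs_cos_le_one _

theorem planeWave_sq_add_sq (ξ x : EuclideanSpace ℝ (Fin d)) :
    planeWave 0 ξ x ^ 2 + planeWave (Real.pi / 2) ξ x ^ 2 = 1 := by
  simp only [planeWave, Real.cos_sub_pi_div_two, sub_zero]
  exact Real.cos_sq_add_sin_sq _

theorem contDiff_planeWave (θ : ℝ) (ξ : EuclideanSpace ℝ (Fin d)) :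
    ContDiff ℝ ∞ (planeWave θ ξ) := by
  unfold planeWave
  have : ContDiff ℝ ∞ fun x : EuclideanSpace ℝ (Fin d) => inner ℝ x ξ :=
    contDiff_id.inner ℝ contDiff_const
  exact Real.contDiff_cos.comp ((contDiff_const.mul this).sub contDiff_const)

theorem continuous_planeWave (θ : ℝ) (ξ : EuclideanSpace ℝ (Fin d)) :
    Continuous (planeWave θ ξ) := (contDiff_planeWave θ ξ).continuous

theorem integrable_planeWave_mul {Ω : Set (EuclideanSpace ℝ (Fin d))}
    {f : EuclideanSpace ℝ (Fin d) → 𝕜} (hf : Integrable f (volume.restrict Ω)) (θ : ℝ)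
    (ξ : EuclideanSpace ℝ (Fin d)) :
    Integrable (fun x => (planeWave θ ξ x : 𝕜) * f x) (volume.restrict Ω) := by
  refine hf.bdd_mul (c := 1)
    ((RCLike.continuous_ofReal.comp (continuous_planeWave θ ξ)).aestronglyMeasurable) ?_
  refine Filter.Eventually.of_forall fun x => ?_
  rw [RCLike.norm_ofReal]
  exact abs_planeWave_le_one θ ξ x

/-- For real `f` the two coefficients are, up to sign, the real and imaginary parts of the Fourier
transform. For complex `f` this fails: the density is then the average of the squared modulus of the
transform at `ξ` and `-ξ`. -/
theorem spectralDensity_eq_norm_sq_fourier {Ω : Set (EuclideanSpace ℝ (Fin d))}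
    (hΩ : MeasurableSet Ω) {f : EuclideanSpace ℝ (Fin d) → ℝ}
    (hf : Integrable f (volume.restrict Ω)) (ξ : EuclideanSpace ℝ (Fin d)) :
    spectralDensity Ω f ξ =
      ‖FourierTransform.fourier (Ω.indicator fun x => (f x : ℂ)) ξ‖ ^ 2 := by
  have hc := integrable_planeWave_mul hf 0 ξ
  have hs := integrable_planeWave_mul hf (Real.pi / 2) ξ
  have hz : FourierTransform.fourier (Ω.indicator fun x => (f x : ℂ)) ξ =
      ((waveCoeff Ω f 0 ξ : ℝ) : ℂ) -
        ((waveCoeff Ω f (Real.pi / 2) ξ : ℝ) : ℂ) * Complex.I := by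
    rw [Real.fourier_eq']
    have hind : (fun x : EuclideanSpace ℝ (Fin d) =>
        Complex.exp (((-2 * Real.pi * inner ℝ x ξ : ℝ) : ℂ) * Complex.I) •
          Ω.indicator (fun x => (f x : ℂ)) x) = Ω.indicator fun x =>
        Complex.exp (((-2 * Real.pi * inner ℝ x ξ : ℝ) : ℂ) * Complex.I) • (f x : ℂ) := by
      funext x
      by_cases hx : x ∈ Ω <;> simp [hx]
    rw [hind, integral_indicator hΩ, waveCoeff, waveCoeff, ← integral_complex_ofReal,
      ← integral_complex_ofReal, ← integral_mul_const,
      ← integral_sub hc.ofReal (hs.ofReal.mul_const _)]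
    refine integral_congr_ae (Filter.Eventually.of_forall fun x => ?_)
    simp only [planeWave, sub_zero, Real.cos_sub_pi_div_two, smul_eq_mul]
    rw [Complex.exp_mul_I]
    push_cast
    rw [show (-2 * (Real.pi : ℂ) * ((inner ℝ x ξ : ℝ) : ℂ)) =
      -(2 * (Real.pi : ℂ) * ((inner ℝ x ξ : ℝ) : ℂ)) by ring, Complex.cos_neg, Complex.sin_neg]
    simp only [RCLike.ofReal_real_eq_id, id]
    push_cast
    ring
  rw [hz, spectralDensity, ← Complex.normSq_eq_norm_sq, Complex.normSq_apply]
  simp [sq]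

theorem integrable_spectralDensity_real {Ω : Set (EuclideanSpace ℝ (Fin d))}
    (hΩ : MeasurableSet Ω) {f : EuclideanSpace ℝ (Fin d) → ℝ}
    (h1 : Integrable f (volume.restrict Ω)) (h2 : MemLp f 2 (volume.restrict Ω)) :
    Integrable (spectralDensity Ω f) ∧ ∫ ξ, spectralDensity Ω f ξ = ∫ x in Ω, ‖f x‖ ^ 2 := by
  have k1 : Integrable (Ω.indicator fun x => (f x : ℂ)) :=
    (integrable_indicator_iff hΩ).2 h1.ofReal
  have k2 : MemLp (Ω.indicator fun x => (f x : ℂ)) 2 volume :=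
    (memLp_indicator_iff_restrict hΩ).2 h2.ofReal
  have e : spectralDensity Ω f = fun ξ =>
      ‖FourierTransform.fourier (Ω.indicator fun x => (f x : ℂ)) ξ‖ ^ 2 :=
    funext fun ξ => spectralDensity_eq_norm_sq_fourier hΩ h1 ξ
  rw [e]
  refine ⟨(memLp_fourier k2 k1).integrable_norm_pow (by norm_num), ?_⟩
  rw [integral_norm_sq_fourier k2 k1, ← integral_indicator hΩ]
  refine integral_congr_ae (Filter.Eventually.of_forall fun x => ?_)
  by_cases hx : x ∈ Ω <;> simp [hx]

theorem re_waveCoeff {Ω : Set (EuclideanSpace ℝ (Fin d))} {f : EuclideanSpace ℝ (Fin d) → 𝕜}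
    (hf : Integrable f (volume.restrict Ω)) (θ : ℝ) (ξ : EuclideanSpace ℝ (Fin d)) :
    RCLike.re (waveCoeff Ω f θ ξ) = waveCoeff Ω (fun x => RCLike.re (f x)) θ ξ := by
  rw [waveCoeff, ← integral_re (integrable_planeWave_mul hf θ ξ)]
  simp [waveCoeff]

theorem im_waveCoeff {Ω : Set (EuclideanSpace ℝ (Fin d))} {f : EuclideanSpace ℝ (Fin d) → 𝕜}
    (hf : Integrable f (volume.restrict Ω)) (θ : ℝ) (ξ : EuclideanSpace ℝ (Fin d)) :
    RCLike.im (waveCoeff Ω f θ ξ) = waveCoeff Ω (fun x => RCLike.im (f x)) θ ξ := by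
  rw [waveCoeff, ← integral_im (integrable_planeWave_mul hf θ ξ)]
  simp [waveCoeff]

/-- Plane waves are real, so real and imaginary parts of `f` contribute separately; this reduces
Plancherel to real functions. -/
theorem spectralDensity_eq_re_add_im {Ω : Set (EuclideanSpace ℝ (Fin d))}
    {f : EuclideanSpace ℝ (Fin d) → 𝕜} (hf : Integrable f (volume.restrict Ω)) :
    spectralDensity Ω f = fun ξ => spectralDensity Ω (fun x => RCLike.re (f x)) ξ +
      spectralDensity Ω (fun x => RCLike.im (f x)) ξ := by
  funext ξ
  simp only [spectralDensity, ← re_waveCoeff hf, ← im_waveCoeff hf, ← RCLike.normSq_eq_def',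
    RCLike.normSq_apply, Real.norm_eq_abs, sq_abs]
  ring

/-- **Plancherel's theorem** for the spectral density. -/
theorem integrable_spectralDensity_and_integral_eq {Ω : Set (EuclideanSpace ℝ (Fin d))}
    (hΩ : MeasurableSet Ω) {f : EuclideanSpace ℝ (Fin d) → 𝕜}
    (h1 : Integrable f (volume.restrict Ω)) (h2 : MemLp f 2 (volume.restrict Ω)) :
    Integrable (spectralDensity Ω f) ∧ ∫ ξ, spectralDensity Ω f ξ = ∫ x in Ω, ‖f x‖ ^ 2 := by
  obtain ⟨ir, er⟩ := integrable_spectralDensity_real hΩ h1.re h2.re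
  obtain ⟨ii, ei⟩ := integrable_spectralDensity_real hΩ h1.im h2.im
  rw [spectralDensity_eq_re_add_im h1]
  refine ⟨ir.add ii, ?_⟩
  rw [integral_add ir ii, er, ei, ← integral_add (h2.re.integrable_norm_pow (by norm_num))
    (h2.im.integrable_norm_pow (by norm_num))]
  refine integral_congr_ae (Filter.Eventually.of_forall fun x => ?_)
  simp only [← RCLike.normSq_eq_def', RCLike.normSq_apply, Real.norm_eq_abs, sq_abs]
  ring

end SpectralDensity

/-! ### Calculus of test functions. -/

section TestFunctions

variable {𝕜 : Type*} [RCLike 𝕜] {d : ℕ} {Ω : Set (EuclideanSpace ℝ (Fin d))}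

theorem classicalGradient_apply (ψ : EuclideanSpace ℝ (Fin d) → 𝕜) (x : EuclideanSpace ℝ (Fin d))
    (i : Fin d) :
    classicalGradient ψ x i = fderiv ℝ ψ x (EuclideanSpace.single i (1 : ℝ)) := rfl

theorem continuous_classicalGradient {ψ : EuclideanSpace ℝ (Fin d) → 𝕜} (hψ : ContDiff ℝ ∞ ψ) :
    Continuous (classicalGradient ψ) := by
  refine (PiLp.continuous_toLp 2 _).comp (continuous_pi fun i => ?_)
  exact (hψ.continuous_fderiv (by simp)).clm_apply continuous_const

theorem classicalGradient_add {ψ χ : EuclideanSpace ℝ (Fin d) → 𝕜} (hψ : ContDiff ℝ ∞ ψ)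
    (hχ : ContDiff ℝ ∞ χ) (x : EuclideanSpace ℝ (Fin d)) :
    classicalGradient (fun x => ψ x + χ x) x = classicalGradient ψ x + classicalGradient χ x := by
  ext i
  rw [PiLp.add_apply, classicalGradient_apply, classicalGradient_apply, classicalGradient_apply,
    fderiv_fun_add (hψ.differentiable (by simp) x) (hχ.differentiable (by simp) x)]
  rfl

theorem classicalGradient_mul {ψ χ : EuclideanSpace ℝ (Fin d) → 𝕜} (hψ : ContDiff ℝ ∞ ψ)
    (hχ : ContDiff ℝ ∞ χ) (x : EuclideanSpace ℝ (Fin d)) :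
    classicalGradient (fun x => ψ x * χ x) x =
      ψ x • classicalGradient χ x + χ x • classicalGradient ψ x := by
  ext i
  rw [PiLp.add_apply, PiLp.smul_apply, PiLp.smul_apply, classicalGradient_apply,
    classicalGradient_apply, classicalGradient_apply,
    fderiv_fun_mul (hψ.differentiable (by simp) x) (hχ.differentiable (by simp) x)]
  rfl

theorem classicalGradient_const_mul {ψ : EuclideanSpace ℝ (Fin d) → 𝕜} (hψ : ContDiff ℝ ∞ ψ)
    (c : 𝕜) (x : EuclideanSpace ℝ (Fin d)) :
    classicalGradient (fun x => c * ψ x) x = c • classicalGradient ψ x := by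
  rw [classicalGradient_mul contDiff_const hψ]
  have : classicalGradient (fun _ : EuclideanSpace ℝ (Fin d) => c) x = 0 := by
    ext i
    rw [classicalGradient_apply]
    simp
  rw [this, smul_zero, add_zero]

namespace IsTestFunction

variable {ψ χ : EuclideanSpace ℝ (Fin d) → 𝕜}

theorem add (hψ : IsTestFunction Ω ψ) (hχ : IsTestFunction Ω χ) :
    IsTestFunction Ω (fun x => ψ x + χ x) where
  contDiff := hψ.contDiff.add hχ.contDiff
  hasCompactSupport := hψ.hasCompactSupport.add hχ.hasCompactSupport
  tsupport_subset := (tsupport_add ψ χ).trans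
    (Set.union_subset hψ.tsupport_subset hχ.tsupport_subset)

theorem mul_left (hχ : ContDiff ℝ ∞ χ) (hψ : IsTestFunction Ω ψ) :
    IsTestFunction Ω (fun x => χ x * ψ x) where
  contDiff := hχ.mul hψ.contDiff
  hasCompactSupport := hψ.hasCompactSupport.mul_left
  tsupport_subset := (closure_mono (Function.support_mul_subset_right _ _)).trans
    hψ.tsupport_subset

theorem zero : IsTestFunction Ω (fun _ => (0 : 𝕜)) where
  contDiff := contDiff_const
  hasCompactSupport := HasCompactSupport.zero
  tsupport_subset := by simp [tsupport, Function.support_fun_zero]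

theorem hasCompactSupport_classicalGradient (hψ : IsTestFunction Ω ψ) :
    HasCompactSupport (classicalGradient ψ) := by
  refine (hψ.hasCompactSupport.fderiv (𝕜 := ℝ)).comp_left
    (g := fun L => (WithLp.toLp 2 fun i => L (EuclideanSpace.single i (1 : ℝ)) :
      EuclideanSpace 𝕜 (Fin d))) ?_
  ext i
  simp

theorem memLp (hψ : IsTestFunction Ω ψ) : MemLp ψ 2 (volume.restrict Ω) :=
  (hψ.contDiff.continuous.memLp_of_hasCompactSupport hψ.hasCompactSupport)

theorem memLp_gradient (hψ : IsTestFunction Ω ψ) :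
    MemLp (classicalGradient ψ) 2 (volume.restrict Ω) :=
  (continuous_classicalGradient hψ.contDiff).memLp_of_hasCompactSupport
    hψ.hasCompactSupport_classicalGradient

theorem eq_zero_of_notMem (hψ : IsTestFunction Ω ψ) {x : EuclideanSpace ℝ (Fin d)} (hx : x ∉ Ω) :
    ψ x = 0 := image_eq_zero_of_notMem_tsupport fun h => hx (hψ.tsupport_subset h)

theorem classicalGradient_eq_zero_of_notMem (hψ : IsTestFunction Ω ψ)
    {x : EuclideanSpace ℝ (Fin d)} (hx : x ∉ Ω) : classicalGradient ψ x = 0 := by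
  have : fderiv ℝ ψ x = 0 := image_eq_zero_of_notMem_tsupport fun h =>
    hx (hψ.tsupport_subset (tsupport_fderiv_subset ℝ h))
  ext i
  rw [classicalGradient_apply, this]
  rfl

/-- Integration by parts of a test function against a smooth function. -/
theorem integral_mul_gradient_add (hψ : IsTestFunction Ω ψ) (hχ : ContDiff ℝ ∞ χ) (i : Fin d) :
    (∫ x in Ω, ψ x * classicalGradient χ x i) + ∫ x in Ω, classicalGradient ψ x i * χ x = 0 := by
  have c1 : Continuous fun x => classicalGradient ψ x i :=
    (EuclideanSpace.proj i : EuclideanSpace 𝕜 (Fin d) →L[𝕜] 𝕜).continuous.comp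
      (continuous_classicalGradient hψ.contDiff)
  have c2 : Continuous fun x => classicalGradient χ x i :=
    (EuclideanSpace.proj i : EuclideanSpace 𝕜 (Fin d) →L[𝕜] 𝕜).continuous.comp
      (continuous_classicalGradient hχ)
  have s1 : HasCompactSupport fun x => classicalGradient ψ x i :=
    hψ.hasCompactSupport_classicalGradient.comp_left
      (g := fun v : EuclideanSpace 𝕜 (Fin d) => v i) rfl
  rw [setIntegral_eq_integral_of_forall_compl_eq_zero fun x hx => by
      rw [hψ.eq_zero_of_notMem hx, zero_mul],
    setIntegral_eq_integral_of_forall_compl_eq_zero fun x hx => by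
      rw [hψ.classicalGradient_eq_zero_of_notMem hx]; simp]
  have := integral_mul_fderiv_eq_neg_fderiv_mul_of_integrable (μ := volume) (f := ψ) (g := χ)
    (v := EuclideanSpace.single i (1 : ℝ))
    ((c1.mul hχ.continuous).integrable_of_hasCompactSupport s1.mul_right)
    ((hψ.contDiff.continuous.mul c2).integrable_of_hasCompactSupport
      hψ.hasCompactSupport.mul_right)
    ((hψ.contDiff.continuous.mul hχ.continuous).integrable_of_hasCompactSupport
      hψ.hasCompactSupport.mul_right)
    (fun x _ => hψ.contDiff.differentiable (by simp) x)
    (fun x _ => hχ.differentiable (by simp) x)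
  simp only [classicalGradient_apply]
  rw [this, neg_add_cancel]

end IsTestFunction

end TestFunctions

/-! ### The form domain as a closed subspace of pairs (function, gradient). -/

section EnergySpace

variable {𝕜 : Type*} [RCLike 𝕜] {d : ℕ} {Ω : Set (EuclideanSpace ℝ (Fin d))}

/-- Pairs of a square integrable function and a square integrable vector field on `Ω`. -/
abbrev FunctionFieldPair (𝕜 : Type*) [RCLike 𝕜] {d : ℕ} (Ω : Set (EuclideanSpace ℝ (Fin d))) :=
  WithLp 2 (Lp 𝕜 2 (volume.restrict Ω) × Lp (EuclideanSpace 𝕜 (Fin d)) 2 (volume.restrict Ω))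

/-- The pair defined by a function and a vector field. -/
noncomputable def mkPair {f : EuclideanSpace ℝ (Fin d) → 𝕜}
    {G : EuclideanSpace ℝ (Fin d) → EuclideanSpace 𝕜 (Fin d)}
    (hf : MemLp f 2 (volume.restrict Ω)) (hG : MemLp G 2 (volume.restrict Ω)) :
    FunctionFieldPair 𝕜 Ω :=
  WithLp.toLp 2 (hf.toLp f, hG.toLp G)

/-- The graph of the classical gradient on test functions. -/
noncomputable def testGraph (𝕜 : Type*) [RCLike 𝕜] {d : ℕ} (Ω : Set (EuclideanSpace ℝ (Fin d))) :
    Submodule 𝕜 (FunctionFieldPair 𝕜 Ω) where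
  carrier := {w | ∃ ψ, ∃ h : IsTestFunction Ω ψ, w = mkPair h.memLp h.memLp_gradient}
  zero_mem' := by
    refine ⟨_, IsTestFunction.zero, ?_⟩
    have : classicalGradient (fun _ : EuclideanSpace ℝ (Fin d) => (0 : 𝕜)) = 0 := by
      ext x i
      rw [classicalGradient_apply]
      simp
    rw [mkPair, ← WithLp.toLp_zero]
    congr 1
    refine Prod.ext (Lp.ext ?_) (Lp.ext ?_)
    · exact (Lp.coeFn_zero _ _ _).trans (MemLp.coeFn_toLp IsTestFunction.zero.memLp).symm
    · have h := (MemLp.coeFn_toLp (IsTestFunction.zero (𝕜 := 𝕜) (Ω := Ω)).memLp_gradient).symm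
      exact (Lp.coeFn_zero _ _ _).trans ((Filter.EventuallyEq.of_eq this.symm).trans h)
  add_mem' := by
    rintro _ _ ⟨ψ, hψ, rfl⟩ ⟨χ, hχ, rfl⟩
    refine ⟨_, hψ.add hχ, ?_⟩
    rw [mkPair, mkPair, mkPair, ← WithLp.toLp_add, Prod.mk_add_mk, ← MemLp.toLp_add,
      ← MemLp.toLp_add]
    congr 2
    refine (MemLp.toLp_eq_toLp_iff _ _).2 (Filter.Eventually.of_forall fun x => ?_)
    exact (classicalGradient_add hψ.contDiff hχ.contDiff x).symm
  smul_mem' := by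
    rintro c _ ⟨ψ, hψ, rfl⟩
    refine ⟨_, hψ.mul_left (χ := fun _ => c) contDiff_const, ?_⟩
    rw [mkPair, mkPair, ← WithLp.toLp_smul, Prod.smul_mk, ← MemLp.toLp_const_smul,
      ← MemLp.toLp_const_smul]
    congr 2
    refine (MemLp.toLp_eq_toLp_iff _ _).2 (Filter.Eventually.of_forall fun x => ?_)
    exact (classicalGradient_const_mul hψ.contDiff c x).symm

theorem mem_testGraph {w : FunctionFieldPair 𝕜 Ω} : w ∈ testGraph 𝕜 Ω ↔
    ∃ ψ, ∃ h : IsTestFunction Ω ψ, w = mkPair h.memLp h.memLp_gradient := Iff.rfl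

/-- The form domain `H¹₀(Ω)`, as the closure of the graph of the gradient on test functions. -/
noncomputable def energySpace (𝕜 : Type*) [RCLike 𝕜] {d : ℕ}
    (Ω : Set (EuclideanSpace ℝ (Fin d))) : Submodule 𝕜 (FunctionFieldPair 𝕜 Ω) :=
  (testGraph 𝕜 Ω).topologicalClosure

theorem norm_sq_mkPair {f : EuclideanSpace ℝ (Fin d) → 𝕜}
    {G : EuclideanSpace ℝ (Fin d) → EuclideanSpace 𝕜 (Fin d)}
    (hf : MemLp f 2 (volume.restrict Ω)) (hG : MemLp G 2 (volume.restrict Ω)) :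
    ‖mkPair hf hG‖ ^ 2 = (∫ x in Ω, ‖f x‖ ^ 2) + ∫ x in Ω, ‖G x‖ ^ 2 := by
  rw [mkPair, WithLp.prod_norm_sq_eq_of_L2]
  exact congrArg₂ (· + ·) (norm_sq_toLp_eq_integral hf) (norm_sq_toLp_eq_integral hG)

theorem mkPair_sub {f g : EuclideanSpace ℝ (Fin d) → 𝕜}
    {G H : EuclideanSpace ℝ (Fin d) → EuclideanSpace 𝕜 (Fin d)}
    (hf : MemLp f 2 (volume.restrict Ω)) (hG : MemLp G 2 (volume.restrict Ω))
    (hg : MemLp g 2 (volume.restrict Ω)) (hH : MemLp H 2 (volume.restrict Ω)) :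
    mkPair hf hG - mkPair hg hH = mkPair (hf.sub hg) (hG.sub hH) := by
  rw [mkPair, mkPair, mkPair, ← WithLp.toLp_sub, Prod.mk_sub_mk, ← MemLp.toLp_sub,
    ← MemLp.toLp_sub]

theorem mkPair_mem_energySpace_iff {f : EuclideanSpace ℝ (Fin d) → 𝕜}
    {G : EuclideanSpace ℝ (Fin d) → EuclideanSpace 𝕜 (Fin d)}
    (hf : MemLp f 2 (volume.restrict Ω)) (hG : MemLp G 2 (volume.restrict Ω)) :
    mkPair hf hG ∈ energySpace 𝕜 Ω ↔ ∀ ε : ℝ, 0 < ε → ∃ ψ : EuclideanSpace ℝ (Fin d) → 𝕜,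
      IsTestFunction Ω ψ ∧ (∫ x in Ω, ‖f x - ψ x‖ ^ 2) +
        (∫ x in Ω, ‖G x - classicalGradient ψ x‖ ^ 2) < ε := by
  have key : ∀ {ψ : EuclideanSpace ℝ (Fin d) → 𝕜} (h : IsTestFunction Ω ψ),
      dist (mkPair hf hG) (mkPair h.memLp h.memLp_gradient) ^ 2 =
      (∫ x in Ω, ‖f x - ψ x‖ ^ 2) + (∫ x in Ω, ‖G x - classicalGradient ψ x‖ ^ 2) := by
    intro ψ h
    rw [dist_eq_norm, mkPair_sub, norm_sq_mkPair]
    rfl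
  rw [energySpace, ← SetLike.mem_coe, Submodule.topologicalClosure_coe, Metric.mem_closure_iff]
  constructor
  · intro h ε hε
    obtain ⟨_, hw, hlt⟩ := h (√ε) (Real.sqrt_pos.2 hε)
    obtain ⟨ψ, hψ, rfl⟩ := mem_testGraph.1 hw
    refine ⟨ψ, hψ, ?_⟩
    rw [← key hψ]
    exact (Real.lt_sqrt dist_nonneg).1 hlt
  · intro h ε hε
    obtain ⟨ψ, hψ, hlt⟩ := h (ε ^ 2) (by positivity)
    refine ⟨_, mem_testGraph.2 ⟨ψ, hψ, rfl⟩, ?_⟩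
    rw [← key hψ] at hlt
    exact lt_of_pow_lt_pow_left₀ 2 hε.le hlt

theorem memLp_of_continuous_of_isBounded {E : Type*} [NormedAddCommGroup E]
    [SecondCountableTopologyEither (EuclideanSpace ℝ (Fin d)) E]
    (hΩ : Bornology.IsBounded Ω) {g : EuclideanSpace ℝ (Fin d) → E} (hg : Continuous g)
    (p : ℝ≥0∞) : MemLp g p (volume.restrict Ω) := by
  have : IsFiniteMeasure (volume.restrict Ω) := ⟨by
    rw [Measure.restrict_apply_univ]; exact hΩ.measure_lt_top⟩
  obtain ⟨C, hC⟩ := hΩ.isCompact_closure.exists_bound_of_continuousOn hg.continuousOn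
  refine MemLp.of_bound hg.aestronglyMeasurable C ?_
  exact ae_mono (Measure.restrict_mono subset_closure le_rfl)
    (ae_restrict_of_forall_mem isClosed_closure.measurableSet hC)

theorem inner_mkPair {f g : EuclideanSpace ℝ (Fin d) → 𝕜}
    {G H : EuclideanSpace ℝ (Fin d) → EuclideanSpace 𝕜 (Fin d)}
    (hf : MemLp f 2 (volume.restrict Ω)) (hG : MemLp G 2 (volume.restrict Ω))
    (hg : MemLp g 2 (volume.restrict Ω)) (hH : MemLp H 2 (volume.restrict Ω)) :
    inner 𝕜 (mkPair hf hG) (mkPair hg hH) =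
      (∫ x in Ω, inner 𝕜 (f x) (g x)) + ∫ x in Ω, inner 𝕜 (G x) (H x) := by
  rw [mkPair, mkPair, WithLp.prod_inner_apply]
  exact congrArg₂ (· + ·) (inner_toLp_eq_integral hf hg) (inner_toLp_eq_integral hG hH)

/-- Here `χ` need not vanish at the boundary; this allows plane waves. The identity says that `(f,
G)` is orthogonal to one fixed pair built from `χ`, square integrable since `Ω` is bounded. It holds
on test functions and passes to the closure. -/
theorem integral_mul_gradient_eq_neg_of_mem_energySpace (hΩ : Bornology.IsBounded Ω)
    {f : EuclideanSpace ℝ (Fin d) → 𝕜}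
    {G : EuclideanSpace ℝ (Fin d) → EuclideanSpace 𝕜 (Fin d)}
    {hf : MemLp f 2 (volume.restrict Ω)} {hG : MemLp G 2 (volume.restrict Ω)}
    (hfG : mkPair hf hG ∈ energySpace 𝕜 Ω)
    {χ : EuclideanSpace ℝ (Fin d) → 𝕜} (hχ : ContDiff ℝ ∞ χ) (i : Fin d) :
    ∫ x in Ω, f x * classicalGradient χ x i = - ∫ x in Ω, G x i * χ x := by
  have c2 : Continuous fun x => (starRingEnd 𝕜) (classicalGradient χ x i) :=
    RCLike.continuous_conj.comp ((EuclideanSpace.proj i :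
      EuclideanSpace 𝕜 (Fin d) →L[𝕜] 𝕜).continuous.comp (continuous_classicalGradient hχ))
  have c3 : Continuous fun x => (starRingEnd 𝕜) (χ x) • EuclideanSpace.single i (1 : 𝕜) :=
    (RCLike.continuous_conj.comp hχ.continuous).smul continuous_const
  have m2 := memLp_of_continuous_of_isBounded hΩ c2 2
  have m3 := memLp_of_continuous_of_isBounded hΩ c3 2
  have key : ∀ {g : EuclideanSpace ℝ (Fin d) → 𝕜}
      {H : EuclideanSpace ℝ (Fin d) → EuclideanSpace 𝕜 (Fin d)}
      (hg : MemLp g 2 (volume.restrict Ω)) (hH : MemLp H 2 (volume.restrict Ω)),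
      inner 𝕜 (mkPair m2 m3) (mkPair hg hH) =
      (∫ x in Ω, g x * classicalGradient χ x i) + ∫ x in Ω, H x i * χ x := by
    intro g H hg hH
    rw [inner_mkPair]
    congr 1
    · simp [RCLike.inner_apply]
    · simp [inner_smul_left, EuclideanSpace.inner_single_left, mul_comm]
  have horth : mkPair m2 m3 ∈ (energySpace 𝕜 Ω)ᗮ := by
    rw [energySpace, Submodule.orthogonal_closure]
    rw [Submodule.mem_orthogonal']
    intro w hw
    obtain ⟨ψ, hψ, rfl⟩ := mem_testGraph.1 hw
    rw [key, hψ.integral_mul_gradient_add hχ i]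
  have := (Submodule.mem_orthogonal' _ _).1 horth _ hfG
  rw [key] at this
  exact eq_neg_of_add_eq_zero_left this

theorem hasH10Gradient_iff (hΩ : Bornology.IsBounded Ω) {f : EuclideanSpace ℝ (Fin d) → 𝕜}
    {G : EuclideanSpace ℝ (Fin d) → EuclideanSpace 𝕜 (Fin d)}
    (hf : MemLp f 2 (volume.restrict Ω)) (hG : MemLp G 2 (volume.restrict Ω)) :
    HasH10Gradient Ω f G ↔ mkPair hf hG ∈ energySpace 𝕜 Ω := by
  refine ⟨fun h => (mkPair_mem_energySpace_iff hf hG).2 h.mem_closure, fun h => ?_⟩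
  exact ⟨⟨hf, hG, fun ψ hψ i =>
    integral_mul_gradient_eq_neg_of_mem_energySpace hΩ h hψ.contDiff i⟩,
    (mkPair_mem_energySpace_iff hf hG).1 h⟩

theorem mkPair_coeFn (w : FunctionFieldPair 𝕜 Ω) :
    mkPair (Lp.memLp w.fst) (Lp.memLp w.snd) = w := by
  rw [mkPair, Lp.toLp_coeFn, Lp.toLp_coeFn]
  rfl

theorem hasH10Gradient_of_mem_energySpace (hΩ : Bornology.IsBounded Ω)
    {w : FunctionFieldPair 𝕜 Ω} (hw : w ∈ energySpace 𝕜 Ω) :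
    HasH10Gradient Ω w.fst w.snd := by
  rw [hasH10Gradient_iff hΩ (Lp.memLp _) (Lp.memLp _), mkPair_coeFn]
  exact hw

theorem HasH10Gradient.mkPair_mem {f : EuclideanSpace ℝ (Fin d) → 𝕜}
    {G : EuclideanSpace ℝ (Fin d) → EuclideanSpace 𝕜 (Fin d)} (h : HasH10Gradient Ω f G) :
    mkPair h.memLp h.memLp_gradient ∈ energySpace 𝕜 Ω :=
  (mkPair_mem_energySpace_iff _ _).2 h.mem_closure

end EnergySpace

/-! ### Plane waves acting on `H¹₀(Ω)`, and the energy in frequency space. -/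

section Waves

variable {𝕜 : Type*} [RCLike 𝕜] {d : ℕ} {Ω : Set (EuclideanSpace ℝ (Fin d))}

/-- A real vector regarded as a vector over `𝕜`. -/
noncomputable def ofRealVector (𝕜 : Type*) [RCLike 𝕜] {d : ℕ} (ξ : EuclideanSpace ℝ (Fin d)) :
    EuclideanSpace 𝕜 (Fin d) :=
  WithLp.toLp 2 fun i => (ξ i : 𝕜)

theorem norm_ofRealVector (ξ : EuclideanSpace ℝ (Fin d)) : ‖ofRealVector 𝕜 ξ‖ = ‖ξ‖ := by
  simp [ofRealVector, EuclideanSpace.norm_eq]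

theorem contDiff_ofReal_planeWave (θ : ℝ) (ξ : EuclideanSpace ℝ (Fin d)) :
    ContDiff ℝ ∞ fun x => (planeWave θ ξ x : 𝕜) :=
  (RCLike.ofRealCLM (K := 𝕜)).contDiff.comp (contDiff_planeWave θ ξ)

/-- Differentiation is a quarter-period shift of the phase, which keeps the family of plane waves
closed under it. -/
theorem classicalGradient_planeWave (θ : ℝ) (ξ x : EuclideanSpace ℝ (Fin d)) :
    classicalGradient (fun x => (planeWave θ ξ x : 𝕜)) x =
      ((2 * Real.pi * planeWave (θ - Real.pi / 2) ξ x : ℝ) : 𝕜) • ofRealVector 𝕜 ξ := by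
  have h1 : HasFDerivAt (fun x => inner ℝ x ξ) (innerSL ℝ ξ) x := by
    simpa [real_inner_comm] using (innerSL ℝ ξ).hasFDerivAt (x := x)
  have h2 := (RCLike.ofRealCLM (K := 𝕜)).hasFDerivAt.comp x
    ((h1.const_mul (2 * Real.pi)).sub_const θ).cos
  ext i
  rw [classicalGradient_apply]
  have h3 : fderiv ℝ (fun x => (planeWave θ ξ x : 𝕜)) x = _ := h2.fderiv
  rw [h3]
  have h4 : planeWave (θ - Real.pi / 2) ξ x = -Real.sin (2 * Real.pi * inner ℝ x ξ - θ) := by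
    rw [planeWave, ← sub_add, Real.cos_add_pi_div_two]
  rw [h4]
  simp [ofRealVector, EuclideanSpace.inner_single_right, RCLike.real_smul_eq_coe_mul,
    RCLike.algebraMap_eq_ofReal]
  ring

theorem HasH10Gradient.memLp_gradient_apply {f : EuclideanSpace ℝ (Fin d) → 𝕜}
    {G : EuclideanSpace ℝ (Fin d) → EuclideanSpace 𝕜 (Fin d)} (h : HasH10Gradient Ω f G)
    (i : Fin d) : MemLp (fun x => G x i) 2 (volume.restrict Ω) :=
  (EuclideanSpace.proj i : EuclideanSpace 𝕜 (Fin d) →L[𝕜] 𝕜).comp_memLp' h.memLp_gradient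

theorem waveCoeff_gradient (hΩ : Bornology.IsBounded Ω) {f : EuclideanSpace ℝ (Fin d) → 𝕜}
    {G : EuclideanSpace ℝ (Fin d) → EuclideanSpace 𝕜 (Fin d)} (h : HasH10Gradient Ω f G)
    (i : Fin d) (θ : ℝ) (ξ : EuclideanSpace ℝ (Fin d)) :
    waveCoeff Ω (fun x => G x i) θ ξ =
      -((2 * Real.pi * ξ i : ℝ) : 𝕜) * waveCoeff Ω f (θ - Real.pi / 2) ξ := by
  have := integral_mul_gradient_eq_neg_of_mem_energySpace hΩ h.mkPair_mem
    (contDiff_ofReal_planeWave (𝕜 := 𝕜) θ ξ) i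
  rw [waveCoeff, waveCoeff]
  simp_rw [mul_comm _ (G _ i)]
  rw [← neg_eq_iff_eq_neg.2 this, neg_mul, ← integral_const_mul]
  congr 1
  refine integral_congr_ae (Filter.Eventually.of_forall fun x => ?_)
  simp only [classicalGradient_planeWave, PiLp.smul_apply, ofRealVector, smul_eq_mul]
  push_cast
  ring

theorem waveCoeff_neg_pi_div_two (f : EuclideanSpace ℝ (Fin d) → 𝕜)
    (ξ : EuclideanSpace ℝ (Fin d)) :
    waveCoeff Ω f (0 - Real.pi / 2) ξ = -waveCoeff Ω f (Real.pi / 2) ξ := by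
  rw [waveCoeff, waveCoeff, ← integral_neg]
  refine integral_congr_ae (Filter.Eventually.of_forall fun x => ?_)
  simp only [planeWave, ← sub_add, sub_zero, Real.cos_add_pi_div_two, Real.cos_sub_pi_div_two]
  push_cast
  ring

theorem spectralDensity_gradient (hΩ : Bornology.IsBounded Ω) {f : EuclideanSpace ℝ (Fin d) → 𝕜}
    {G : EuclideanSpace ℝ (Fin d) → EuclideanSpace 𝕜 (Fin d)} (h : HasH10Gradient Ω f G)
    (i : Fin d) (ξ : EuclideanSpace ℝ (Fin d)) :
    spectralDensity Ω (fun x => G x i) ξ = 4 * Real.pi ^ 2 * ξ i ^ 2 * spectralDensity Ω f ξ := by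
  rw [spectralDensity, spectralDensity, waveCoeff_gradient hΩ h, waveCoeff_gradient hΩ h,
    waveCoeff_neg_pi_div_two, sub_self]
  simp only [norm_mul, norm_neg, RCLike.norm_ofReal, mul_pow, sq_abs]
  ring

theorem isFiniteMeasure_restrict_of_isBounded (hΩ : Bornology.IsBounded Ω) :
    IsFiniteMeasure (volume.restrict Ω) :=
  ⟨by rw [Measure.restrict_apply_univ]; exact hΩ.measure_lt_top⟩

theorem spectralDensity_of_memLp (hΩ : Bornology.IsBounded Ω) (hm : MeasurableSet Ω)
    {f : EuclideanSpace ℝ (Fin d) → 𝕜} (hf : MemLp f 2 (volume.restrict Ω)) :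
    Integrable (spectralDensity Ω f) ∧ ∫ ξ, spectralDensity Ω f ξ = ∫ x in Ω, ‖f x‖ ^ 2 :=
  have := isFiniteMeasure_restrict_of_isBounded hΩ
  integrable_spectralDensity_and_integral_eq hm (hf.integrable one_le_two) hf

/-- The Dirichlet energy in terms of the spectral density. -/
theorem HasH10Gradient.integral_norm_sq_mul_spectralDensity (hΩ : Bornology.IsBounded Ω)
    (hm : MeasurableSet Ω) {f : EuclideanSpace ℝ (Fin d) → 𝕜}
    {G : EuclideanSpace ℝ (Fin d) → EuclideanSpace 𝕜 (Fin d)} (h : HasH10Gradient Ω f G) :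
    Integrable (fun ξ => 4 * Real.pi ^ 2 * ‖ξ‖ ^ 2 * spectralDensity Ω f ξ) ∧
      ∫ ξ, 4 * Real.pi ^ 2 * ‖ξ‖ ^ 2 * spectralDensity Ω f ξ = ∫ x in Ω, ‖G x‖ ^ 2 := by
  have e : (fun ξ => 4 * Real.pi ^ 2 * ‖ξ‖ ^ 2 * spectralDensity Ω f ξ) =
      fun ξ => ∑ i, spectralDensity Ω (fun x => G x i) ξ := by
    funext ξ
    simp only [spectralDensity_gradient hΩ h, EuclideanSpace.real_norm_sq_eq, Finset.mul_sum,
      Finset.sum_mul]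
  have hi := fun i => spectralDensity_of_memLp hΩ hm (h.memLp_gradient_apply i)
  rw [e]
  refine ⟨integrable_finsetSum _ fun i _ => (hi i).1, ?_⟩
  rw [integral_finsetSum _ fun i _ => (hi i).1]
  simp only [(hi _).2]
  rw [← integral_finsetSum _ fun i _ =>
    (h.memLp_gradient_apply i).integrable_norm_pow (by norm_num)]
  simp only [EuclideanSpace.norm_sq_eq]

theorem memLp_planeWave_smul {E : Type*} [NormedAddCommGroup E] [NormedSpace 𝕜 E]
    {p : ℝ≥0∞} {f : EuclideanSpace ℝ (Fin d) → E} (hf : MemLp f p (volume.restrict Ω)) (θ : ℝ)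
    (ξ : EuclideanSpace ℝ (Fin d)) :
    MemLp (fun x => (planeWave θ ξ x : 𝕜) • f x) p (volume.restrict Ω) := by
  refine hf.of_le_mul (c := 1) (((RCLike.continuous_ofReal.comp
    (continuous_planeWave θ ξ)).aestronglyMeasurable).smul hf.1) ?_
  refine Filter.Eventually.of_forall fun x => ?_
  rw [norm_smul, RCLike.norm_ofReal]
  exact mul_le_mul_of_nonneg_right (abs_planeWave_le_one θ ξ x) (norm_nonneg _)

theorem norm_add_sq_le_two_mul {E : Type*} [SeminormedAddCommGroup E] (a b : E) :
    ‖a + b‖ ^ 2 ≤ 2 * ‖a‖ ^ 2 + 2 * ‖b‖ ^ 2 := by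
  have := norm_add_le a b
  nlinarith [sq_nonneg (‖a‖ - ‖b‖), norm_nonneg (a + b), norm_nonneg a, norm_nonneg b]

/-- `H¹₀(Ω)` is stable under multiplication by plane waves. -/
theorem HasH10Gradient.planeWave_mul (hΩ : Bornology.IsBounded Ω)
    {f : EuclideanSpace ℝ (Fin d) → 𝕜}
    {G : EuclideanSpace ℝ (Fin d) → EuclideanSpace 𝕜 (Fin d)} (h : HasH10Gradient Ω f G)
    (θ : ℝ) (ξ : EuclideanSpace ℝ (Fin d)) :
    HasH10Gradient Ω (fun x => (planeWave θ ξ x : 𝕜) * f x)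
      (fun x => (planeWave θ ξ x : 𝕜) • G x +
        (((2 * Real.pi : ℝ) : 𝕜) * ((planeWave (θ - Real.pi / 2) ξ x : 𝕜) * f x)) •
          ofRealVector 𝕜 ξ) := by
  have m1 : MemLp (fun x => (planeWave θ ξ x : 𝕜) * f x) 2 (volume.restrict Ω) :=
    memLp_planeWave_smul (𝕜 := 𝕜) h.memLp θ ξ
  have m2 : MemLp (fun x => (planeWave (θ - Real.pi / 2) ξ x : 𝕜) * f x) 2 (volume.restrict Ω) :=
    memLp_planeWave_smul (𝕜 := 𝕜) h.memLp _ ξ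
  have m3 : MemLp (fun x => (((2 * Real.pi : ℝ) : 𝕜) *
      ((planeWave (θ - Real.pi / 2) ξ x : 𝕜) * f x)) • ofRealVector 𝕜 ξ) 2
      (volume.restrict Ω) := by
    exact ((ContinuousLinearMap.id 𝕜 𝕜).smulRight (ofRealVector 𝕜 ξ)).comp_memLp'
      (m2.const_mul ((2 * Real.pi : ℝ) : 𝕜))
  have m4 := (memLp_planeWave_smul (𝕜 := 𝕜) h.memLp_gradient θ ξ).add m3
  refine (hasH10Gradient_iff hΩ m1 m4).2 ((mkPair_mem_energySpace_iff _ _).2 fun ε hε => ?_)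
  -- `c` bounds the squared gradient of the wave. After `‖a + b‖² ≤ 2‖a‖² + 2‖b‖²`, the error for
  -- the product is at most `1 + 2c` times the function error plus twice the gradient error, whence
  -- the factor `2 + 2c`.
  set c : ℝ := (2 * Real.pi * ‖ξ‖) ^ 2 with hc
  have hc0 : 0 ≤ c := by positivity
  obtain ⟨ψ, hψ, hlt⟩ := h.mem_closure (ε / (2 + 2 * c)) (by positivity)
  refine ⟨_, hψ.mul_left (contDiff_ofReal_planeWave θ ξ), ?_⟩
  have i1 : Integrable (fun x => ‖f x - ψ x‖ ^ 2) (volume.restrict Ω) :=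
    (h.memLp.sub hψ.memLp).integrable_norm_pow (by norm_num)
  have i2 : Integrable (fun x => ‖G x - classicalGradient ψ x‖ ^ 2) (volume.restrict Ω) :=
    (h.memLp_gradient.sub hψ.memLp_gradient).integrable_norm_pow (by norm_num)
  have b1 : ∫ x in Ω, ‖(planeWave θ ξ x : 𝕜) * f x - (planeWave θ ξ x : 𝕜) * ψ x‖ ^ 2 ≤
      ∫ x in Ω, ‖f x - ψ x‖ ^ 2 := by
    refine integral_mono_of_nonneg (Filter.Eventually.of_forall fun x => by positivity) i1
      (Filter.Eventually.of_forall fun x => ?_)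
    simp only
    rw [← mul_sub, norm_mul, RCLike.norm_ofReal]
    gcongr
    exact mul_le_of_le_one_left (norm_nonneg _) (abs_planeWave_le_one θ ξ x)
  have b2 : ∫ x in Ω, ‖((planeWave θ ξ x : 𝕜) • G x +
        (((2 * Real.pi : ℝ) : 𝕜) * ((planeWave (θ - Real.pi / 2) ξ x : 𝕜) * f x)) •
          ofRealVector 𝕜 ξ) -
        classicalGradient (fun x => (planeWave θ ξ x : 𝕜) * ψ x) x‖ ^ 2 ≤
      ∫ x in Ω, (2 * ‖G x - classicalGradient ψ x‖ ^ 2 + 2 * c * ‖f x - ψ x‖ ^ 2) := by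
    refine integral_mono_of_nonneg (Filter.Eventually.of_forall fun x => by positivity)
      ((i2.const_mul 2).add (i1.const_mul (2 * c))) (Filter.Eventually.of_forall fun x => ?_)
    simp only
    rw [classicalGradient_mul (contDiff_ofReal_planeWave θ ξ) hψ.contDiff,
      classicalGradient_planeWave]
    have e : ((planeWave θ ξ x : 𝕜) • G x +
        (((2 * Real.pi : ℝ) : 𝕜) * ((planeWave (θ - Real.pi / 2) ξ x : 𝕜) * f x)) •
          ofRealVector 𝕜 ξ) - ((planeWave θ ξ x : 𝕜) • classicalGradient ψ x +
          ψ x • ((2 * Real.pi * planeWave (θ - Real.pi / 2) ξ x : ℝ) : 𝕜) • ofRealVector 𝕜 ξ) =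
        (planeWave θ ξ x : 𝕜) • (G x - classicalGradient ψ x) +
          (((2 * Real.pi : ℝ) : 𝕜) * ((planeWave (θ - Real.pi / 2) ξ x : 𝕜) * (f x - ψ x))) •
            ofRealVector 𝕜 ξ := by
      push_cast
      module
    rw [e]
    refine (norm_add_sq_le_two_mul _ _).trans ?_
    rw [norm_smul, norm_smul, norm_mul, norm_mul, norm_ofRealVector, RCLike.norm_ofReal,
      RCLike.norm_ofReal, RCLike.norm_ofReal, abs_of_pos Real.two_pi_pos, mul_assoc 2 c]
    have a1 := abs_planeWave_le_one θ ξ x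
    have a2 := abs_planeWave_le_one (θ - Real.pi / 2) ξ x
    gcongr
    · exact mul_le_of_le_one_left (norm_nonneg _) a1
    · rw [hc, ← mul_pow]
      refine pow_le_pow_left₀ (by positivity) ?_ 2
      calc _ ≤ 2 * Real.pi * (1 * ‖f x - ψ x‖) * ‖ξ‖ := by gcongr
        _ = _ := by ring
  rw [integral_add (i2.const_mul 2) (i1.const_mul (2 * c)), integral_const_mul,
    integral_const_mul] at b2
  have n1 : 0 ≤ ∫ x in Ω, ‖f x - ψ x‖ ^ 2 := integral_nonneg fun x => by positivity
  have n2 : 0 ≤ ∫ x in Ω, ‖G x - classicalGradient ψ x‖ ^ 2 :=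
    integral_nonneg fun x => by positivity
  rw [lt_div_iff₀ (by positivity)] at hlt
  refine lt_of_le_of_lt (add_le_add b1 b2) (lt_of_le_of_lt ?_ hlt)
  nlinarith [mul_nonneg hc0 n2]

end Waves

/-! ### Compactness criterion and completeness of eigenvectors of `J J*`. -/

section CompactOperators

variable {𝕜 H L : Type*} [RCLike 𝕜] [NormedAddCommGroup H] [InnerProductSpace 𝕜 H]
  [CompleteSpace H] [NormedAddCommGroup L] [InnerProductSpace 𝕜 L] [CompleteSpace L]

/-- An operator that is small on the preimage of the orthogonal complement of a suitable finite
dimensional space is compact. -/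
theorem isCompactOperator_of_forall_norm_le (J : H →L[𝕜] L)
    (hJ : ∀ ε : ℝ, 0 < ε → ∃ F : Submodule 𝕜 L, FiniteDimensional 𝕜 F ∧
      ∀ h, J h ∈ Fᗮ → ‖J h‖ ≤ ε * ‖h‖) : IsCompactOperator J := by
  refine isClosed_setOfPred_isCompactOperator.closure_subset (Metric.mem_closure_iff.2 ?_)
  intro ε hε
  obtain ⟨F, hF, hle⟩ := hJ (ε / 2) (by positivity)
  -- Vectors orthogonal to `J* F` are mapped by `J` into `Fᗮ`, where the hypothesis applies. Hence
  -- `J` is within `ε / 2` of the finite rank operator `J` composed with the projection onto `F'`.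
  set F' : Submodule 𝕜 H := F.map (J.adjoint : L →ₗ[𝕜] H) with hF'
  have : FiniteDimensional 𝕜 F' := inferInstance
  have : ProperSpace F' := FiniteDimensional.proper 𝕜 F'
  refine ⟨J ∘L F'.starProjection, ?_, ?_⟩
  · have h1 : IsCompactOperator (J ∘L F'.subtypeL) :=
      isCompactOperator_of_locallyCompactSpace_rng _
    exact h1.comp_clm F'.orthogonalProjectionOnto
  · rw [dist_eq_norm]
    refine lt_of_le_of_lt (ContinuousLinearMap.opNorm_le_bound _ (by positivity)
      (M := ε / 2) fun h => ?_) (half_lt_self hε)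
    have hk : h - F'.starProjection h ∈ F'ᗮ := F'.sub_starProjection_mem_orthogonal h
    have hJk : J (h - F'.starProjection h) ∈ Fᗮ := by
      rw [Submodule.mem_orthogonal]
      intro y hy
      rw [← ContinuousLinearMap.adjoint_inner_left]
      exact (Submodule.mem_orthogonal _ _).1 hk _ (Submodule.mem_map_of_mem hy)
    have e : (J - J ∘L F'.starProjection) h = J (h - F'.starProjection h) := by simp
    rw [e]
    refine (hle _ hJk).trans ?_
    gcongr
    have e2 : h - F'.starProjection h = F'ᗮ.starProjection h := by
      simp [Submodule.starProjection_orthogonal]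
    rw [e2]
    exact F'ᗮ.norm_starProjection_apply_le h

/-- `v` satisfies the eigenvector equation `J J* v = c v`. -/
def IsGramEigenvector (J : H →L[𝕜] L) (c : 𝕜) (v : L) : Prop :=
  J (J.adjoint v) = c • v

/-- If `J` is compact with dense range then a family of eigenvectors of `J J*` to which no
eigenvector is orthogonal spans a dense subspace. -/
theorem orthogonal_span_eq_bot_of_exhaustive {ι : Type*} {J : H →L[𝕜] L}
    (hJ : IsCompactOperator J) (hinj : ∀ v, (∀ w, inner 𝕜 (J w) v = 0) → v = 0) {u : ι → L}
    (hu : ∀ j, ∃ c : 𝕜, IsGramEigenvector J c (u j))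
    (hex : ∀ (κ : ℝ) (v : L), κ ≠ 0 → v ≠ 0 → IsGramEigenvector J (κ : 𝕜) v →
      ∃ j, inner 𝕜 (u j) v ≠ 0) : (Submodule.span 𝕜 (Set.range u))ᗮ = ⊥ := by
  set M := (Submodule.span 𝕜 (Set.range u))ᗮ with hM
  set K : L →L[𝕜] L := J ∘L J.adjoint with hK
  have hsymm : ∀ x y, inner 𝕜 (K x) y = inner 𝕜 x (K y) := fun x y => by
    simp only [hK, ContinuousLinearMap.comp_apply]
    rw [← ContinuousLinearMap.adjoint_inner_right, ContinuousLinearMap.adjoint_inner_left]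
  have hKM : ∀ v ∈ M, K v ∈ M := by
    intro v hv
    have hle : Submodule.span 𝕜 (Set.range u) ≤ (Submodule.span 𝕜 {K v})ᗮ := by
      rw [Submodule.span_le]
      rintro _ ⟨j, rfl⟩
      rw [SetLike.mem_coe, Submodule.mem_orthogonal_singleton_iff_inner_left, ← hsymm]
      obtain ⟨c, hc⟩ := hu j
      change inner 𝕜 (J (J.adjoint (u j))) v = 0
      rw [hc, inner_smul_left, (Submodule.mem_orthogonal _ _).1 hv _
        (Submodule.subset_span ⟨j, rfl⟩), mul_zero]
    rw [hM, Submodule.mem_orthogonal']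
    intro w hw
    exact (Submodule.mem_orthogonal_singleton_iff_inner_right.1 (hle hw))
  have hKsymm : (K : L →ₗ[𝕜] L).IsSymmetric := hsymm
  have hKc : IsCompactOperator K := hJ.comp_clm J.adjoint
  have hSc : IsCompactOperator (K.restrict hKM) := hKc.restrict' (f := (K : L →ₗ[𝕜] L)) hKM
  have hSs : (K.restrict hKM : M →ₗ[𝕜] M).IsSymmetric := hKsymm.restrict_invariant hKM
  -- An eigenvector of the restriction to `M` would be an eigenvector of `J J*` orthogonal to all `u
  -- j`. The value `0` is excluded separately: `J J* v = 0` forces `J* v = 0`, so `v` is orthogonal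
  -- to the dense range of `J`.
  have hbot : ∀ c : 𝕜, Module.End.eigenspace (K.restrict hKM : M →ₗ[𝕜] M) c = ⊥ := by
    intro c
    by_contra hne
    obtain ⟨v, hv, hv0⟩ := Submodule.exists_mem_ne_zero_of_ne_bot hne
    have hvc : K (v : L) = c • (v : L) :=
      congrArg Subtype.val (Module.End.mem_eigenspace_iff.1 hv)
    have hcr : starRingEnd 𝕜 c = c := hSs.conj_eigenvalue_eq_self hne
    obtain ⟨κ, rfl⟩ := RCLike.conj_eq_iff_real.1 hcr
    have hv0' : (v : L) ≠ 0 := fun h => hv0 (Subtype.ext h)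
    have hκ : κ ≠ 0 := by
      rintro rfl
      have hz : J (J.adjoint (v : L)) = 0 := by simpa [hK] using hvc
      have h0 : J.adjoint (v : L) = 0 := by
        rw [← inner_self_eq_zero (𝕜 := 𝕜), ContinuousLinearMap.adjoint_inner_left, hz,
          inner_zero_right]
      refine hv0' (hinj _ fun w => ?_)
      rw [← ContinuousLinearMap.adjoint_inner_right, h0, inner_zero_right]
    obtain ⟨j, hj⟩ := hex κ v hκ hv0' hvc
    exact hj ((Submodule.mem_orthogonal _ _).1 v.2 _ (Submodule.subset_span ⟨j, rfl⟩))
  -- A compact symmetric operator without eigenvectors lives on the zero space.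
  have := ContinuousLinearMap.orthogonalComplement_iSup_eigenspaces_eq_bot hSc hSs
  simp only [hbot, iSup_bot, Submodule.bot_orthogonal_eq_top] at this
  rw [← Submodule.subsingleton_iff_eq_bot]
  exact (Submodule.subsingleton_iff 𝕜).1 (subsingleton_of_top_le_bot this.le)

/-- Parseval's identity for a complete orthonormal family of eigenvectors of `J J*`. -/
theorem hasSum_norm_sq_inner_of_exhaustive {ι : Type*} {J : H →L[𝕜] L}
    (hJ : IsCompactOperator J) (hinj : ∀ v, (∀ w, inner 𝕜 (J w) v = 0) → v = 0) {u : ι → L}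
    (hon : Orthonormal 𝕜 u) (hu : ∀ j, ∃ c : 𝕜, IsGramEigenvector J c (u j))
    (hex : ∀ (κ : ℝ) (v : L), κ ≠ 0 → v ≠ 0 → IsGramEigenvector J (κ : 𝕜) v →
      ∃ j, inner 𝕜 (u j) v ≠ 0) (v : L) :
    HasSum (fun j => ‖inner 𝕜 (u j) v‖ ^ 2) (‖v‖ ^ 2) := by
  set b := HilbertBasis.mkOfOrthogonalEqBot hon
    (orthogonal_span_eq_bot_of_exhaustive hJ hinj hu hex)
  have hbj : ∀ j, b j = u j := fun j => by
    simp only [b, HilbertBasis.coe_mkOfOrthogonalEqBot]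
  have h := b.hasSum_inner_mul_inner v v
  rw [← RCLike.hasSum_ofReal 𝕜]
  convert! h using 2 with j
  · rw [hbj, ← inner_conj_symm v, RCLike.conj_mul]
    push_cast; rfl
  · rw [inner_self_eq_norm_sq_to_K]
    push_cast; rfl

/-- The hypothesis is a weak eigenvalue equation in `H`; it amounts to `e = c J* J e`, and `J` is
applied to both sides. -/
theorem isGramEigenvector_apply {J : H →L[𝕜] L} {e : H} {c : 𝕜} (he : J e ≠ 0)
    (h : ∀ w, inner 𝕜 w e = c * inner 𝕜 (J w) (J e)) :
    IsGramEigenvector J c⁻¹ (J e) := by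
  have key : e = c • J.adjoint (J e) := by
    refine ext_inner_left 𝕜 fun w => ?_
    rw [inner_smul_right, ContinuousLinearMap.adjoint_inner_right, h]
  have hc : c ≠ 0 := by
    rintro rfl
    rw [zero_smul] at key
    exact he (by rw [key, map_zero])
  rw [IsGramEigenvector, eq_inv_smul_iff₀ hc, ← map_smul, ← key]

theorem IsGramEigenvector.exists_apply_eq {J : H →L[𝕜] L} {v : L} {κ : 𝕜} (hκ : κ ≠ 0)
    (hv : IsGramEigenvector J κ v) :
    ∃ e, J e = v ∧ ∀ w, inner 𝕜 w e = κ⁻¹ * inner 𝕜 (J w) (J e) := by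
  have he : J (κ⁻¹ • J.adjoint v) = v := by
    rw [map_smul, show J (J.adjoint v) = κ • v from hv, inv_smul_smul₀ hκ]
  refine ⟨_, he, fun w => ?_⟩
  rw [he, inner_smul_right, ContinuousLinearMap.adjoint_inner_right]

end CompactOperators

/-! ### Rellich's theorem through Fourier analysis. -/

section Embedding

variable {𝕜 : Type*} [RCLike 𝕜] {d : ℕ} {Ω : Set (EuclideanSpace ℝ (Fin d))}

/-- The plane wave as an element of `L²(Ω)`. -/
noncomputable def planeWaveLp (𝕜 : Type*) [RCLike 𝕜] (hΩ : Bornology.IsBounded Ω) (θ : ℝ)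
    (ξ : EuclideanSpace ℝ (Fin d)) : Lp 𝕜 2 (volume.restrict Ω) :=
  (memLp_of_continuous_of_isBounded hΩ
    (contDiff_ofReal_planeWave (𝕜 := 𝕜) θ ξ).continuous 2).toLp _

theorem inner_planeWaveLp (hΩ : Bornology.IsBounded Ω) {f : EuclideanSpace ℝ (Fin d) → 𝕜}
    (hf : MemLp f 2 (volume.restrict Ω)) (θ : ℝ) (ξ : EuclideanSpace ℝ (Fin d)) :
    inner 𝕜 (planeWaveLp 𝕜 hΩ θ ξ) (hf.toLp f) = waveCoeff Ω f θ ξ := by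
  rw [planeWaveLp, inner_toLp_eq_integral, waveCoeff]
  simp [RCLike.inner_apply, mul_comm]

/-- The cosine is 1-Lipschitz and `‖x‖` is bounded on `Ω`, so the map is even Lipschitz. Its image
of a ball of frequencies is therefore compact and has finite nets. -/
theorem continuous_planeWaveLp (hΩ : Bornology.IsBounded Ω) (θ : ℝ) :
    Continuous (planeWaveLp 𝕜 hΩ θ) := by
  have := isFiniteMeasure_restrict_of_isBounded hΩ
  obtain ⟨ρ, hρ⟩ := hΩ.isCompact_closure.isBounded.exists_norm_le
  have hρ0 : 0 ≤ max ρ 0 := le_max_right _ _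
  have hae : ∀ᵐ x ∂volume.restrict Ω, ‖x‖ ≤ max ρ 0 :=
    ae_mono (Measure.restrict_mono subset_closure le_rfl)
      (ae_restrict_of_forall_mem isClosed_closure.measurableSet
        fun x hx => (hρ x hx).trans (le_max_left _ _))
  set C : ℝ := measureUnivNNReal (volume.restrict Ω) ^ (2 : ℝ≥0∞).toReal⁻¹ *
    (2 * Real.pi * max ρ 0)
  have hC : 0 ≤ C := by positivity
  refine (LipschitzWith.of_dist_le_mul (K := C.toNNReal) fun ξ η => ?_).continuous
  rw [dist_eq_norm, dist_eq_norm, planeWaveLp, planeWaveLp, ← MemLp.toLp_sub]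
  have hm := fun ζ => memLp_of_continuous_of_isBounded hΩ
    (contDiff_ofReal_planeWave (𝕜 := 𝕜) θ ζ).continuous 2
  refine (Lp.norm_le_of_ae_bound (C := 2 * Real.pi * max ρ 0 * ‖ξ - η‖) (by positivity)
    ?_).trans_eq ?_
  · filter_upwards [((hm ξ).sub (hm η)).coeFn_toLp, hae] with x hx hxρ
    rw [hx, Pi.sub_apply, ← RCLike.ofReal_sub, RCLike.norm_ofReal]
    refine (Real.abs_cos_sub_cos_le _ _).trans ?_
    rw [sub_sub_sub_cancel_right, ← mul_sub, ← inner_sub_right, abs_mul,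
      abs_of_pos Real.two_pi_pos, mul_assoc (2 * Real.pi)]
    gcongr
    exact (abs_real_inner_le_norm _ _).trans (by gcongr)
  · rw [Real.coe_toNNReal _ hC]; ring

theorem spectralDensity_le_of_mem_orthogonal (hΩ : Bornology.IsBounded Ω)
    {F : Submodule 𝕜 (Lp 𝕜 2 (volume.restrict Ω))} {f : EuclideanSpace ℝ (Fin d) → 𝕜}
    (hf : MemLp f 2 (volume.restrict Ω)) (hfF : hf.toLp f ∈ Fᗮ)
    {η : ℝ} {ξ : EuclideanSpace ℝ (Fin d)}
    (h0 : ∃ y ∈ F, dist (planeWaveLp 𝕜 hΩ 0 ξ) y ≤ η)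
    (h1 : ∃ y ∈ F, dist (planeWaveLp 𝕜 hΩ (Real.pi / 2) ξ) y ≤ η) :
    spectralDensity Ω f ξ ≤ 2 * η ^ 2 * ∫ x in Ω, ‖f x‖ ^ 2 := by
  have key : ∀ θ : ℝ, (∃ y ∈ F, dist (planeWaveLp 𝕜 hΩ θ ξ) y ≤ η) →
      ‖waveCoeff Ω f θ ξ‖ ^ 2 ≤ η ^ 2 * ∫ x in Ω, ‖f x‖ ^ 2 := by
    rintro θ ⟨y, hy, hle⟩
    rw [← norm_sq_toLp_eq_integral hf, ← mul_pow, ← inner_planeWaveLp hΩ hf,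
      ← sub_zero (inner 𝕜 _ _), ← (Submodule.mem_orthogonal _ _).1 hfF y hy, ← inner_sub_left]
    refine pow_le_pow_left₀ (norm_nonneg _) ((norm_inner_le_norm _ _).trans ?_) 2
    rw [← dist_eq_norm]
    gcongr
  have := key 0 h0
  have := key _ h1
  rw [spectralDensity]
  linarith

/-- Functions in `H¹₀(Ω)` orthogonal to a suitable finite dimensional space have small `L²` norm
compared with their energy. -/
theorem exists_finiteDimensional_integral_norm_sq_le (𝕜 : Type*) [RCLike 𝕜]
    (hΩ : Bornology.IsBounded Ω) (hm : MeasurableSet Ω) {ε : ℝ} (hε : 0 < ε) :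
    ∃ F : Submodule 𝕜 (Lp 𝕜 2 (volume.restrict Ω)), FiniteDimensional 𝕜 F ∧
      ∀ (f : EuclideanSpace ℝ (Fin d) → 𝕜)
        (G : EuclideanSpace ℝ (Fin d) → EuclideanSpace 𝕜 (Fin d)) (h : HasH10Gradient Ω f G),
        h.memLp.toLp f ∈ Fᗮ → ∫ x in Ω, ‖f x‖ ^ 2 ≤
          ε ^ 2 * ((∫ x in Ω, ‖f x‖ ^ 2) + ∫ x in Ω, ‖G x‖ ^ 2) := by
  set B := Metric.closedBall (0 : EuclideanSpace ℝ (Fin d)) ε⁻¹ with hB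
  set V : ℝ := volume.real B with hV
  have hV0 : 0 ≤ V := measureReal_nonneg
  -- Chosen so that the low frequencies, of volume `V` and density at most `2 η² N`, contribute at
  -- most `ε² N / 2`; the `+ 1` avoids a separate discussion of `V = 0`.
  set η : ℝ := √(ε ^ 2 / (4 * (V + 1))) with hη
  have hηpos : 0 < η := Real.sqrt_pos.2 (by positivity)
  have hη2 : η ^ 2 = ε ^ 2 / (4 * (V + 1)) := Real.sq_sqrt (by positivity)
  have hnet : ∀ θ : ℝ, ∃ s : Set (Lp 𝕜 2 (volume.restrict Ω)), s.Finite ∧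
      ∀ ξ ∈ B, ∃ y ∈ s, dist (planeWaveLp 𝕜 hΩ θ ξ) y ≤ η := by
    intro θ
    have hc : IsCompact (planeWaveLp 𝕜 hΩ θ '' B) :=
      (isCompact_closedBall _ _).image (continuous_planeWaveLp hΩ θ)
    obtain ⟨s, hs, hcov⟩ := Metric.totallyBounded_iff.1 hc.totallyBounded η hηpos
    refine ⟨s, hs, fun ξ hξ => ?_⟩
    obtain ⟨y, hy, hlt⟩ := Set.mem_iUnion₂.1 (hcov (Set.mem_image_of_mem _ hξ))
    exact ⟨y, hy, (Metric.mem_ball.1 hlt).le⟩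
  obtain ⟨s0, hs0, hn0⟩ := hnet 0
  obtain ⟨s1, hs1, hn1⟩ := hnet (Real.pi / 2)
  -- `F` is spanned by `η`-nets of the cosines and sines of frequency at most `ε⁻¹`. Orthogonality
  -- to `F` makes the low frequency part small.
  refine ⟨Submodule.span 𝕜 (s0 ∪ s1), FiniteDimensional.span_of_finite 𝕜 (hs0.union hs1), ?_⟩
  intro f G hH hfF
  set N := ∫ x in Ω, ‖f x‖ ^ 2
  have hN0 : 0 ≤ N := integral_nonneg fun x => by positivity
  obtain ⟨i0, e0⟩ := spectralDensity_of_memLp hΩ hm hH.memLp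
  obtain ⟨i1, e1⟩ := hH.integral_norm_sq_mul_spectralDensity hΩ hm
  have hBfin : volume B ≠ ⊤ := measure_closedBall_lt_top.ne
  have i2 : Integrable (B.indicator fun _ => 2 * η ^ 2 * N) :=
    (integrable_indicator_iff measurableSet_closedBall).2
      (integrableOn_const hBfin)
  have hpt : ∀ ξ, spectralDensity Ω f ξ ≤ B.indicator (fun _ => 2 * η ^ 2 * N) ξ +
      ε ^ 2 / 2 * (4 * Real.pi ^ 2 * ‖ξ‖ ^ 2 * spectralDensity Ω f ξ) := by
    intro ξ
    have hsd := spectralDensity_nonneg Ω f ξ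
    by_cases hξ : ξ ∈ B
    · rw [Set.indicator_of_mem hξ]
      obtain ⟨y0, hy0, hd0⟩ := hn0 ξ hξ
      obtain ⟨y1, hy1, hd1⟩ := hn1 ξ hξ
      have := spectralDensity_le_of_mem_orthogonal hΩ hH.memLp hfF
        ⟨y0, Submodule.subset_span (Or.inl hy0), hd0⟩
        ⟨y1, Submodule.subset_span (Or.inr hy1), hd1⟩
      have h0 : 0 ≤ ε ^ 2 / 2 * (4 * Real.pi ^ 2 * ‖ξ‖ ^ 2 * spectralDensity Ω f ξ) := by
        positivity
      linarith
    · rw [Set.indicator_of_notMem hξ, zero_add]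
      rw [hB, mem_closedBall_zero_iff, not_le] at hξ
      -- High frequencies are absorbed by the energy, since `2π² ε² ‖ξ‖² ≥ 1`.
      have h1 : 1 < ε * ‖ξ‖ := by
        rwa [inv_lt_iff_one_lt_mul₀' hε] at hξ
      have h2 : 1 ≤ (ε * ‖ξ‖) ^ 2 := one_le_pow₀ h1.le
      have h3 : 1 ≤ Real.pi ^ 2 := one_le_pow₀ (by linarith [Real.pi_gt_three])
      have h4 : 1 ≤ 2 * (Real.pi ^ 2 * (ε * ‖ξ‖) ^ 2) := by
        nlinarith [one_le_mul_of_one_le_of_one_le h3 h2]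
      calc spectralDensity Ω f ξ ≤ 2 * (Real.pi ^ 2 * (ε * ‖ξ‖) ^ 2) * spectralDensity Ω f ξ :=
            le_mul_of_one_le_left hsd h4
        _ = _ := by ring
  have hint := integral_mono i0 (i2.add (i1.const_mul (ε ^ 2 / 2))) hpt
  simp only [Pi.add_apply] at hint
  rw [integral_add i2 (i1.const_mul _), integral_const_mul, e0, e1,
    integral_indicator_const _ measurableSet_closedBall, smul_eq_mul, ← hV, hη2] at hint
  have hfin : V * (2 * (ε ^ 2 / (4 * (V + 1))) * N) ≤ ε ^ 2 / 2 * N := by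
    have : V * (2 * (ε ^ 2 / (4 * (V + 1))) * N) = (V / (V + 1)) * (ε ^ 2 / 2 * N) := by
      field_simp; ring
    rw [this]
    refine mul_le_of_le_one_left (by positivity) ?_
    rw [div_le_one (by positivity)]
    linarith
  have hE0 : 0 ≤ ∫ x in Ω, ‖G x‖ ^ 2 := integral_nonneg fun x => by positivity
  nlinarith [mul_nonneg (sq_nonneg ε) hN0, mul_nonneg (sq_nonneg ε) hE0]

/-- The form domain `H¹₀(Ω)` as a Hilbert space, with the graph norm. -/
def EnergySpace (𝕜 : Type*) [RCLike 𝕜] {d : ℕ} (Ω : Set (EuclideanSpace ℝ (Fin d))) :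
    Type _ := energySpace 𝕜 Ω

noncomputable instance : NormedAddCommGroup (EnergySpace 𝕜 Ω) :=
  inferInstanceAs (NormedAddCommGroup (energySpace 𝕜 Ω))

noncomputable instance : InnerProductSpace 𝕜 (EnergySpace 𝕜 Ω) :=
  inferInstanceAs (InnerProductSpace 𝕜 (energySpace 𝕜 Ω))

instance : CompleteSpace (EnergySpace 𝕜 Ω) :=
  (testGraph 𝕜 Ω).isClosed_topologicalClosure.completeSpace_coe

/-- The embedding of the energy space into `L²(Ω)`. -/
noncomputable def energyEmbedding (𝕜 : Type*) [RCLike 𝕜] {d : ℕ}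
    (Ω : Set (EuclideanSpace ℝ (Fin d))) :
    EnergySpace 𝕜 Ω →L[𝕜] Lp 𝕜 2 (volume.restrict Ω) :=
  (WithLp.fstL 2 𝕜 _ _) ∘L (energySpace 𝕜 Ω).subtypeL

/-- A function in `H¹₀(Ω)` as an element of the energy space. -/
noncomputable def HasH10Gradient.toEnergy {f : EuclideanSpace ℝ (Fin d) → 𝕜}
    {G : EuclideanSpace ℝ (Fin d) → EuclideanSpace 𝕜 (Fin d)} (h : HasH10Gradient Ω f G) :
    EnergySpace 𝕜 Ω :=
  (⟨mkPair h.memLp h.memLp_gradient, h.mkPair_mem⟩ : energySpace 𝕜 Ω)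

theorem HasH10Gradient.energyEmbedding_toEnergy {f : EuclideanSpace ℝ (Fin d) → 𝕜}
    {G : EuclideanSpace ℝ (Fin d) → EuclideanSpace 𝕜 (Fin d)} (h : HasH10Gradient Ω f G) :
    energyEmbedding 𝕜 Ω h.toEnergy = h.memLp.toLp f := rfl

theorem HasH10Gradient.inner_toEnergy {f g : EuclideanSpace ℝ (Fin d) → 𝕜}
    {G H : EuclideanSpace ℝ (Fin d) → EuclideanSpace 𝕜 (Fin d)} (h : HasH10Gradient Ω f G)
    (h' : HasH10Gradient Ω g H) : inner 𝕜 h.toEnergy h'.toEnergy =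
      (∫ x in Ω, inner 𝕜 (f x) (g x)) + ∫ x in Ω, inner 𝕜 (G x) (H x) :=
  inner_mkPair h.memLp h.memLp_gradient h'.memLp h'.memLp_gradient

theorem HasH10Gradient.norm_sq_toEnergy {f : EuclideanSpace ℝ (Fin d) → 𝕜}
    {G : EuclideanSpace ℝ (Fin d) → EuclideanSpace 𝕜 (Fin d)} (h : HasH10Gradient Ω f G) :
    ‖h.toEnergy‖ ^ 2 = (∫ x in Ω, ‖f x‖ ^ 2) + ∫ x in Ω, ‖G x‖ ^ 2 :=
  norm_sq_mkPair h.memLp h.memLp_gradient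

theorem exists_eq_toEnergy (hΩ : Bornology.IsBounded Ω) (w : EnergySpace 𝕜 Ω) :
    ∃ (G : EuclideanSpace ℝ (Fin d) → EuclideanSpace 𝕜 (Fin d))
      (h : HasH10Gradient Ω (energyEmbedding 𝕜 Ω w) G), h.toEnergy = w :=
  ⟨_, hasH10Gradient_of_mem_energySpace hΩ (Subtype.prop (p := (· ∈ energySpace 𝕜 Ω)) w),
    Subtype.ext (mkPair_coeFn _)⟩

/-- **Rellich's theorem** for the form domain of the Dirichlet Laplacian. -/
theorem isCompactOperator_energyEmbedding (hΩ : Bornology.IsBounded Ω) (hm : MeasurableSet Ω) :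
    IsCompactOperator (energyEmbedding 𝕜 Ω) := by
  refine isCompactOperator_of_forall_norm_le _ fun ε hε => ?_
  obtain ⟨F, hF, hle⟩ := exists_finiteDimensional_integral_norm_sq_le 𝕜 hΩ hm hε
  refine ⟨F, hF, fun w hw => ?_⟩
  obtain ⟨G, hG, hGw⟩ := exists_eq_toEnergy hΩ w
  have h1 := hle _ _ hG (by rw [Lp.toLp_coeFn]; exact hw)
  rw [← hG.norm_sq_toEnergy, hGw, ← Lp.norm_sq_eq_integral, ← mul_pow] at h1
  exact (pow_le_pow_iff_left₀ (norm_nonneg _) (by positivity) two_ne_zero).1 h1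

end Embedding

/-! ### Dirichlet eigenfunctions as eigenvectors of `J J*`: Parseval and the energy Bessel
inequality. -/

section Completeness

variable {𝕜 : Type*} [RCLike 𝕜] {d : ℕ} {Ω : Set (EuclideanSpace ℝ (Fin d))}

theorem IsDirichletEigenfunction.memLp {μ : ℝ} {v : EuclideanSpace ℝ (Fin d) → 𝕜}
    (hv : IsDirichletEigenfunction Ω μ v) : MemLp v 2 (volume.restrict Ω) := by
  obtain ⟨-, G, hG, -⟩ := hv.eigen
  exact hG.memLp

/-- The weak form of the eigenvalue equation, in the energy space. -/
theorem IsDirichletEigenfunction.exists_inner_eq {μ : ℝ} {v : EuclideanSpace ℝ (Fin d) → 𝕜}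
    (hv : IsDirichletEigenfunction Ω μ v) :
    ∃ G, ∃ hG : HasH10Gradient Ω v G,
      (∀ w H (h : HasH10Gradient Ω w H),
        inner 𝕜 h.toEnergy hG.toEnergy =
          ((1 + μ : ℝ) : 𝕜) * inner 𝕜 (h.memLp.toLp w) (hv.memLp.toLp v)) ∧
      ∫ x in Ω, ‖G x‖ ^ 2 = μ * ∫ x in Ω, ‖v x‖ ^ 2 := by
  obtain ⟨-, G, hG, hform⟩ := hv.eigen
  have hform' : ∀ w H, HasH10Gradient Ω w H →
      ∫ x in Ω, inner 𝕜 (H x) (G x) = (μ : 𝕜) * ∫ x in Ω, inner 𝕜 (w x) (v x) := by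
    intro w H h
    rw [hform w H h, ← integral_const_mul]
    congr 1
    funext x
    exact inner_smul_right _ _ _
  refine ⟨G, hG, fun w H h => ?_, ?_⟩
  · rw [HasH10Gradient.inner_toEnergy, hform' w H h, inner_toLp_eq_integral]
    push_cast
    ring
  -- Testing the equation with the eigenfunction itself gives its energy.
  · have := hform' v G hG
    simp_rw [inner_self_eq_norm_sq_to_K] at this
    simp_rw [← RCLike.ofReal_pow] at this
    rw [integral_ofReal, integral_ofReal] at this
    exact_mod_cast this

/-- Test functions lie in the range of the embedding and determine a locally integrable function
almost everywhere on the open set `Ω`. -/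
theorem eq_zero_of_forall_inner_energyEmbedding_eq_zero (hΩ : IsOpen Ω)
    {v : Lp 𝕜 2 (volume.restrict Ω)}
    (hv : ∀ w, inner 𝕜 (energyEmbedding 𝕜 Ω w) v = 0) : v = 0 := by
  have hloc : LocallyIntegrableOn v Ω volume :=
    locallyIntegrableOn_of_locallyIntegrable_restrict
      ((Lp.memLp v).locallyIntegrable one_le_two)
  have hae := hΩ.ae_eq_zero_of_integral_contDiff_smul_eq_zero hloc ?_
  · rw [Lp.eq_zero_iff_ae_eq_zero]
    exact (ae_restrict_iff' hΩ.measurableSet).2 hae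
  intro g hg hgc hgs
  have hs : Function.support (fun x => (g x : 𝕜)) = Function.support g := by
    ext x; simp
  have hψ : IsTestFunction Ω fun x => (g x : 𝕜) :=
    { contDiff := (RCLike.ofRealCLM (K := 𝕜)).contDiff.comp hg
      hasCompactSupport := hgc.comp_left (g := fun r : ℝ => (r : 𝕜)) (by simp)
      tsupport_subset := by rw [tsupport, hs]; exact hgs }
  have h0 : inner 𝕜 (hψ.memLp.toLp _) v = 0 :=
    hv (⟨_, (testGraph 𝕜 Ω).le_topologicalClosure (mem_testGraph.2 ⟨_, hψ, rfl⟩)⟩ :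
      energySpace 𝕜 Ω)
  rw [← Lp.toLp_coeFn v (Lp.memLp v), inner_toLp_eq_integral] at h0
  rw [← setIntegral_eq_integral_of_forall_compl_eq_zero (s := Ω), ← h0]
  · congr 1
    funext x
    rw [RCLike.inner_apply, RCLike.conj_ofReal, RCLike.real_smul_eq_coe_mul, mul_comm]
  · intro x hx
    rw [image_eq_zero_of_notMem_tsupport fun h => hx (hgs h), zero_smul]

theorem isGramEigenvector_of_eigenfunction (hΩ : Bornology.IsBounded Ω) {μ : ℝ}
    {v : EuclideanSpace ℝ (Fin d) → 𝕜} (hv : IsDirichletEigenfunction Ω μ v) :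
    ∃ c : 𝕜, IsGramEigenvector (energyEmbedding 𝕜 Ω) c (hv.memLp.toLp v) := by
  obtain ⟨G, hG, hinner, -⟩ := hv.exists_inner_eq
  refine ⟨((1 + μ : ℝ) : 𝕜)⁻¹, isGramEigenvector_apply (e := hG.toEnergy) ?_ fun w => ?_⟩
  · rw [hG.energyEmbedding_toEnergy, Ne, Lp.eq_zero_iff_ae_eq_zero]
    exact fun h => hv.ne_zero ((MemLp.coeFn_toLp hv.memLp).symm.trans h)
  · obtain ⟨H, hH, hw⟩ := exists_eq_toEnergy hΩ w
    rw [← hw, hinner _ _ hH]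
    rfl

/-- Since `J J*` inverts `1 - Δ`, the value `κ` corresponds to `1 + μ = κ⁻¹`. This lets `exhaustive`
be used for eigenvectors of `J J*`. -/
theorem isDirichletEigenfunction_of_energyEmbedding (hΩ : Bornology.IsBounded Ω) {κ : ℝ}
    (hκ : κ ≠ 0) {v : Lp 𝕜 2 (volume.restrict Ω)} (hv0 : v ≠ 0)
    (hv : IsGramEigenvector (energyEmbedding 𝕜 Ω) (κ : 𝕜) v) :
    IsDirichletEigenfunction Ω (κ⁻¹ - 1) v := by
  have hκ' : (κ : 𝕜) ≠ 0 := by exact_mod_cast hκ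
  obtain ⟨e, rfl, he⟩ := hv.exists_apply_eq hκ'
  obtain ⟨G, hG, hGe⟩ := exists_eq_toEnergy hΩ e
  refine ⟨⟨(Lp.memLp _).const_mul _, G, hG, ?_⟩, ?_⟩
  · intro w H hwH
    have h1 := he hwH.toEnergy
    rw [← hGe, HasH10Gradient.inner_toEnergy, hwH.energyEmbedding_toEnergy,
      hG.energyEmbedding_toEnergy, inner_toLp_eq_integral] at h1
    rw [eq_sub_of_add_eq' h1]
    have h2 : ∀ x, inner 𝕜 (w x) (((κ⁻¹ - 1 : ℝ) : 𝕜) * energyEmbedding 𝕜 Ω e x) =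
        ((κ⁻¹ - 1 : ℝ) : 𝕜) * inner 𝕜 (w x) (energyEmbedding 𝕜 Ω e x) := fun x => by
      rw [← smul_eq_mul, inner_smul_right]
    simp_rw [h2]
    rw [integral_const_mul]
    push_cast
    ring
  · exact fun h => hv0 ((Lp.eq_zero_iff_ae_eq_zero).2 h)

namespace IsDirichletEigenSequence

variable {lam : ℕ → ℝ} {u : ℕ → EuclideanSpace ℝ (Fin d) → 𝕜}

/-- The eigenfunctions as elements of `L²(Ω)`. -/
noncomputable def uLp (hu : IsDirichletEigenSequence Ω lam u) (j : ℕ) :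
    Lp 𝕜 2 (volume.restrict Ω) :=
  (hu.eigenfunction j).memLp.toLp (u j)

theorem inner_uLp (hu : IsDirichletEigenSequence Ω lam u) (j : ℕ)
    {g : EuclideanSpace ℝ (Fin d) → 𝕜} (hg : MemLp g 2 (volume.restrict Ω)) :
    inner 𝕜 (hu.uLp j) (hg.toLp g) = ∫ x in Ω, inner 𝕜 (u j x) (g x) :=
  inner_toLp_eq_integral _ _

theorem orthonormal_uLp (hu : IsDirichletEigenSequence Ω lam u) : Orthonormal 𝕜 hu.uLp := by
  rw [orthonormal_iff_ite]
  intro i j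
  rw [← hu.orthonormal i j, ← hu.inner_uLp i (hu.eigenfunction j).memLp]
  rfl

theorem integral_norm_sq_eq_one (hu : IsDirichletEigenSequence Ω lam u) (j : ℕ) :
    ∫ x in Ω, ‖u j x‖ ^ 2 = 1 := by
  rw [← norm_sq_toLp_eq_integral (hu.eigenfunction j).memLp]
  have := hu.orthonormal_uLp.1 j
  rw [uLp] at this
  rw [this, one_pow]

/-- Parseval's identity: the eigenfunctions of the Dirichlet Laplacian are complete in `L²(Ω)`. -/
theorem hasSum_norm_sq_inner (hu : IsDirichletEigenSequence Ω lam u) (hΩ : IsOpen Ω)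
    (hb : Bornology.IsBounded Ω) (v : Lp 𝕜 2 (volume.restrict Ω)) :
    HasSum (fun j => ‖inner 𝕜 (hu.uLp j) v‖ ^ 2) (‖v‖ ^ 2) := by
  refine hasSum_norm_sq_inner_of_exhaustive (J := energyEmbedding 𝕜 Ω)
    (isCompactOperator_energyEmbedding hb hΩ.measurableSet) ?_ hu.orthonormal_uLp
    (fun j => isGramEigenvector_of_eigenfunction hb (hu.eigenfunction j)) ?_ v
  · exact fun v hv => eq_zero_of_forall_inner_energyEmbedding_eq_zero hΩ hv
  · intro κ v hκ hv0 hv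
    obtain ⟨j, hj⟩ := hu.exhaustive _ _
      (isDirichletEigenfunction_of_energyEmbedding hb hκ hv0 hv)
    refine ⟨j, ?_⟩
    rw [← Lp.toLp_coeFn v (Lp.memLp v), hu.inner_uLp]
    exact hj

/-- Bessel's inequality in the energy space. -/
theorem sum_mul_norm_sq_inner_le (hu : IsDirichletEigenSequence Ω lam u)
    {g : EuclideanSpace ℝ (Fin d) → 𝕜}
    {G : EuclideanSpace ℝ (Fin d) → EuclideanSpace 𝕜 (Fin d)} (hg : HasH10Gradient Ω g G)
    (s : Finset ℕ) :
    ∑ j ∈ s, (1 + lam j) * ‖inner 𝕜 (hu.uLp j) (hg.memLp.toLp g)‖ ^ 2 ≤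
      (∫ x in Ω, ‖g x‖ ^ 2) + ∫ x in Ω, ‖G x‖ ^ 2 := by
  choose E hE hinner hen using fun j => (hu.eigenfunction j).exists_inner_eq
  have hpos : ∀ j, 0 < 1 + lam j := fun j => by
    have h0 : 0 ≤ ∫ x in Ω, ‖E j x‖ ^ 2 := integral_nonneg fun x => by positivity
    rw [hen j, hu.integral_norm_sq_eq_one, mul_one] at h0
    linarith
  -- The `u j` are orthogonal in the graph inner product with squared norm `1 + lam j`. After
  -- normalisation, the squared coefficients of `g` are `1 + lam j` times those in `L²(Ω)`.
  obtain ⟨e, he⟩ : ∃ e : ℕ → EnergySpace 𝕜 Ω, e = fun j =>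
    ((√(1 + lam j) : ℝ) : 𝕜)⁻¹ • (hE j).toEnergy := ⟨_, rfl⟩
  have hsq : ∀ j, ((√(1 + lam j) : ℝ) : 𝕜) * ((√(1 + lam j) : ℝ) : 𝕜) = ((1 + lam j : ℝ) : 𝕜) :=
    fun j => by rw [← RCLike.ofReal_mul, Real.mul_self_sqrt (hpos j).le]
  have hs0 : ∀ j, ((√(1 + lam j) : ℝ) : 𝕜) ≠ 0 := fun j => by
    exact_mod_cast (Real.sqrt_pos.2 (hpos j)).ne'
  have hon : Orthonormal 𝕜 e := by
    rw [orthonormal_iff_ite]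
    intro i j
    have h1 := hinner j _ _ (hE i)
    have h2 := (orthonormal_iff_ite.1 hu.orthonormal_uLp) i j
    change inner 𝕜 ((hE i).memLp.toLp (u i)) ((hu.eigenfunction j).memLp.toLp (u j)) = _ at h2
    rw [h2] at h1
    simp only [he, inner_smul_left, inner_smul_right]
    rw [h1]
    split_ifs with hij
    · subst hij
      rw [← hsq, map_inv₀, RCLike.conj_ofReal]
      field_simp [hs0 i]
    · simp
  have hb := hon.sum_inner_products_le hg.toEnergy (s := s)
  rw [hg.norm_sq_toEnergy] at hb
  refine le_of_eq_of_le (Finset.sum_congr rfl fun j _ => ?_) hb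
  have h1 : ‖inner 𝕜 (hE j).toEnergy hg.toEnergy‖ =
      (1 + lam j) * ‖inner 𝕜 (hu.uLp j) (hg.memLp.toLp g)‖ := by
    rw [norm_inner_symm, hinner j _ _ hg, norm_mul, RCLike.norm_ofReal, abs_of_pos (hpos j),
      norm_inner_symm]
    rfl
  have h2 : ‖((√(1 + lam j) : ℝ) : 𝕜)⁻¹‖ ^ 2 = (1 + lam j)⁻¹ := by
    rw [norm_inv, RCLike.norm_ofReal, inv_pow, sq_abs, Real.sq_sqrt (hpos j).le]
  simp only [he, inner_smul_left]
  rw [norm_mul, RCLike.norm_conj, mul_pow, h1, h2]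
  have := (hpos j).ne'
  field_simp

end IsDirichletEigenSequence

end Completeness

/-! ### Gaussian integral, convergence of the heat trace, and Jensen's inequality. -/

section HeatTrace

variable {𝕜 : Type*} [RCLike 𝕜] {d : ℕ} {Ω : Set (EuclideanSpace ℝ (Fin d))}

theorem waveCoeff_eq_inner_planeWaveLp (hb : Bornology.IsBounded Ω)
    {f : EuclideanSpace ℝ (Fin d) → 𝕜} (hf : MemLp f 2 (volume.restrict Ω)) (θ : ℝ)
    (ξ : EuclideanSpace ℝ (Fin d)) :
    ‖waveCoeff Ω f θ ξ‖ = ‖inner 𝕜 (hf.toLp f) (planeWaveLp 𝕜 hb θ ξ)‖ := by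
  rw [norm_inner_symm, inner_planeWaveLp]

theorem norm_sq_planeWaveLp_add (hb : Bornology.IsBounded Ω) (ξ : EuclideanSpace ℝ (Fin d)) :
    ‖planeWaveLp 𝕜 hb 0 ξ‖ ^ 2 + ‖planeWaveLp 𝕜 hb (Real.pi / 2) ξ‖ ^ 2 = volume.real Ω := by
  have hm := fun θ => memLp_of_continuous_of_isBounded hb
    (contDiff_ofReal_planeWave (𝕜 := 𝕜) θ ξ).continuous 2
  rw [planeWaveLp, planeWaveLp, norm_sq_toLp_eq_integral, norm_sq_toLp_eq_integral,
    ← integral_add ((hm _).integrable_norm_pow (by norm_num))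
      ((hm _).integrable_norm_pow (by norm_num))]
  simp only [RCLike.norm_ofReal, sq_abs, planeWave_sq_add_sq]
  simp

theorem gaussian_integral_eq {t : ℝ} (ht : 0 < t) :
    Integrable (fun ξ : EuclideanSpace ℝ (Fin d) =>
        Real.exp (-(4 * Real.pi ^ 2 * ‖ξ‖ ^ 2 * t))) ∧
      ∫ ξ : EuclideanSpace ℝ (Fin d), Real.exp (-(4 * Real.pi ^ 2 * ‖ξ‖ ^ 2 * t)) =
        (4 * Real.pi * t) ^ (-((d : ℝ) / 2)) := by
  have hb : 0 < 4 * Real.pi ^ 2 * t := by positivity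
  have e : (fun ξ : EuclideanSpace ℝ (Fin d) => Real.exp (-(4 * Real.pi ^ 2 * ‖ξ‖ ^ 2 * t))) =
      fun ξ => Real.exp (-(4 * Real.pi ^ 2 * t) * ‖ξ‖ ^ 2) := by
    funext ξ; congr 1; ring
  have hval := GaussianFourier.integral_rexp_neg_mul_sq_norm
    (V := EuclideanSpace ℝ (Fin d)) hb
  rw [e]
  have hv2 : ∫ ξ : EuclideanSpace ℝ (Fin d), Real.exp (-(4 * Real.pi ^ 2 * t) * ‖ξ‖ ^ 2) =
      (4 * Real.pi * t) ^ (-((d : ℝ) / 2)) := by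
    rw [hval, finrank_euclideanSpace_fin, Real.rpow_neg (by positivity),
      ← Real.inv_rpow (by positivity)]
    congr 1
    field_simp
  refine ⟨?_, hv2⟩
  -- Integrability comes from the value: the integral of a non-integrable function is `0` by
  -- convention, whereas the computed one is positive.
  by_contra hni
  rw [integral_undef hni] at hv2
  exact (Real.rpow_pos_of_pos (by positivity) _).ne hv2

/-- The graph of `b ↦ exp(-b t)` lies above its tangent at `a`. Averaging this over `b`, with `a`
the mean or a bound for it, is the form of Jensen's inequality used below. -/
theorem exp_tangent_le (a b t : ℝ) :
    Real.exp (-(a * t)) * (1 + a * t - b * t) ≤ Real.exp (-(b * t)) := by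
  have h := Real.add_one_le_exp (a * t - b * t)
  calc _ ≤ Real.exp (-(a * t)) * Real.exp (a * t - b * t) := by
        gcongr; linarith
    _ = _ := by rw [← Real.exp_add]; congr 1; ring

namespace IsDirichletEigenSequence

variable {lam : ℕ → ℝ} {u : ℕ → EuclideanSpace ℝ (Fin d) → 𝕜}

theorem eigenvalue_nonneg (hu : IsDirichletEigenSequence Ω lam u) (j : ℕ) : 0 ≤ lam j := by
  obtain ⟨G, hG, -, he⟩ := (hu.eigenfunction j).exists_inner_eq
  rw [hu.integral_norm_sq_eq_one, mul_one] at he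
  rw [← he]
  exact integral_nonneg fun x => by positivity

/-- Jensen's inequality: the density of `u j` has integral `1`, and the mean of `4π²‖ξ‖²` under it
is the energy `lam j`. -/
theorem exp_neg_le_integral (hu : IsDirichletEigenSequence Ω lam u) (hb : Bornology.IsBounded Ω)
    (hm : MeasurableSet Ω) {t : ℝ} (ht : 0 < t) (j : ℕ) :
    Integrable (fun ξ => Real.exp (-(4 * Real.pi ^ 2 * ‖ξ‖ ^ 2 * t)) *
        spectralDensity Ω (u j) ξ) ∧
      Real.exp (-(lam j * t)) ≤ ∫ ξ, Real.exp (-(4 * Real.pi ^ 2 * ‖ξ‖ ^ 2 * t)) *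
        spectralDensity Ω (u j) ξ := by
  obtain ⟨G, hG, -, he⟩ := (hu.eigenfunction j).exists_inner_eq
  obtain ⟨i0, e0⟩ := spectralDensity_of_memLp hb hm (hu.eigenfunction j).memLp
  obtain ⟨i1, e1⟩ := hG.integral_norm_sq_mul_spectralDensity hb hm
  rw [hu.integral_norm_sq_eq_one] at e0
  rw [hu.integral_norm_sq_eq_one, mul_one] at he
  rw [he] at e1
  have hint : Integrable (fun ξ => Real.exp (-(4 * Real.pi ^ 2 * ‖ξ‖ ^ 2 * t)) *
      spectralDensity Ω (u j) ξ) := by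
    refine i0.bdd_mul (c := 1) (by fun_prop) (Filter.Eventually.of_forall fun ξ => ?_)
    rw [Real.norm_eq_abs, Real.abs_exp, Real.exp_le_one_iff, neg_nonpos]
    positivity
  refine ⟨hint, ?_⟩
  have hi2 : Integrable fun ξ => Real.exp (-(lam j * t)) *
      ((1 + lam j * t) * spectralDensity Ω (u j) ξ -
        t * (4 * Real.pi ^ 2 * ‖ξ‖ ^ 2 * spectralDensity Ω (u j) ξ)) :=
    ((i0.const_mul _).sub (i1.const_mul t)).const_mul _
  have := integral_mono hi2 hint fun ξ => by
    have h := mul_le_mul_of_nonneg_right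
      (exp_tangent_le (lam j) (4 * Real.pi ^ 2 * ‖ξ‖ ^ 2) t) (spectralDensity_nonneg Ω (u j) ξ)
    refine le_of_eq_of_le ?_ h
    ring
  rw [integral_const_mul, integral_sub (i0.const_mul _) (i1.const_mul t), integral_const_mul,
    integral_const_mul, e0, e1] at this
  refine le_of_eq_of_le ?_ this
  ring

/-- Read as coefficients of the two plane waves along the orthonormal `u j`, the densities obey
Bessel; the squared norms of the waves add up to the volume. -/
theorem sum_spectralDensity_le (hu : IsDirichletEigenSequence Ω lam u)
    (hb : Bornology.IsBounded Ω) (s : Finset ℕ) (ξ : EuclideanSpace ℝ (Fin d)) :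
    ∑ j ∈ s, spectralDensity Ω (u j) ξ ≤ volume.real Ω := by
  rw [← norm_sq_planeWaveLp_add (𝕜 := 𝕜) hb ξ]
  simp only [spectralDensity]
  rw [Finset.sum_add_distrib]
  simp only [waveCoeff_eq_inner_planeWaveLp hb (hu.eigenfunction _).memLp]
  exact add_le_add (hu.orthonormal_uLp.sum_inner_products_le _)
    (hu.orthonormal_uLp.sum_inner_products_le _)

/-- The heat trace converges, and is bounded by the Gaussian one. -/
theorem summable_exp_neg (hu : IsDirichletEigenSequence Ω lam u) (hb : Bornology.IsBounded Ω)
    (hm : MeasurableSet Ω) {t : ℝ} (ht : 0 < t) :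
    Summable fun j => Real.exp (-(lam j * t)) := by
  obtain ⟨ig, -⟩ := gaussian_integral_eq (d := d) ht
  refine summable_of_sum_le (c := ∫ ξ : EuclideanSpace ℝ (Fin d),
    Real.exp (-(4 * Real.pi ^ 2 * ‖ξ‖ ^ 2 * t)) * volume.real Ω) (fun j => (Real.exp_pos _).le)
    fun s => ?_
  calc ∑ j ∈ s, Real.exp (-(lam j * t)) ≤ ∑ j ∈ s, ∫ ξ,
        Real.exp (-(4 * Real.pi ^ 2 * ‖ξ‖ ^ 2 * t)) * spectralDensity Ω (u j) ξ :=
        Finset.sum_le_sum fun j _ => (hu.exp_neg_le_integral hb hm ht j).2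
    _ = ∫ ξ, ∑ j ∈ s,
        Real.exp (-(4 * Real.pi ^ 2 * ‖ξ‖ ^ 2 * t)) * spectralDensity Ω (u j) ξ :=
        (integral_finsetSum _ fun j _ => (hu.exp_neg_le_integral hb hm ht j).1).symm
    _ ≤ _ := by
        refine integral_mono
          (integrable_finsetSum _ fun j _ => (hu.exp_neg_le_integral hb hm ht j).1)
          (ig.mul_const _) fun ξ => ?_
        simp only
        rw [← Finset.mul_sum]
        gcongr
        exact hu.sum_spectralDensity_le hb s ξ

end IsDirichletEigenSequence

/-- Jensen's inequality for the exponential, for series. -/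
theorem mul_exp_le_tsum {lam p : ℕ → ℝ} {P D t : ℝ} (hP : 0 < P) (ht : 0 < t)
    (hlam : ∀ j, 0 ≤ lam j) (hp : ∀ j, 0 ≤ p j) (hsum : HasSum p P)
    (hD : ∀ s : Finset ℕ, ∑ j ∈ s, (1 + lam j) * p j ≤ P + D)
    (he : Summable fun j => Real.exp (-(lam j * t)) * p j) :
    P * Real.exp (-(D / P * t)) ≤ ∑' j, Real.exp (-(lam j * t)) * p j := by
  have h1 : Summable fun j => (1 + lam j) * p j :=
    summable_of_sum_le (fun j => mul_nonneg (by linarith [hlam j]) (hp j)) hD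
  have h2 : ∑' j, (1 + lam j) * p j ≤ P + D := h1.tsum_le_of_sum_le hD
  -- The tangent is taken at `D / P`, an upper bound for the mean of `lam`. The extra `t`
  -- compensates for the `1` in `1 + lam j`.
  have h3 := ((hsum.mul_left (1 + D / P * t + t)).sub (h1.hasSum.mul_left t)).mul_left
    (Real.exp (-(D / P * t)))
  refine le_trans ?_ (hasSum_le (fun j => ?_) h3 he.hasSum)
  · rw [mul_comm]
    gcongr
    have : D / P * t * P = t * D := by field_simp
    nlinarith
  · have := mul_le_mul_of_nonneg_right (exp_tangent_le (D / P) (lam j) t) (hp j)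
    refine le_of_eq_of_le ?_ this
    ring

theorem norm_sq_rotation {E : Type*} [NormedAddCommGroup E] [InnerProductSpace 𝕜 E] {c s : ℝ}
    (h : c ^ 2 + s ^ 2 = 1) (X Y : E) :
    ‖(c : 𝕜) • X - (s : 𝕜) • Y‖ ^ 2 + ‖(s : 𝕜) • X + (c : 𝕜) • Y‖ ^ 2 = ‖X‖ ^ 2 + ‖Y‖ ^ 2 := by
  rw [@norm_sub_sq 𝕜, @norm_add_sq 𝕜]
  simp only [inner_smul_left, inner_smul_right, norm_smul, RCLike.norm_ofReal, RCLike.conj_ofReal,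
    mul_pow, sq_abs, RCLike.re_ofReal_mul]
  linear_combination (‖X‖ ^ 2 + ‖Y‖ ^ 2) * h

end HeatTrace

/-! ### Coherent states, integration over frequencies, and the two bounds. -/

section Main

variable {𝕜 : Type*} [RCLike 𝕜] {d : ℕ} {Ω : Set (EuclideanSpace ℝ (Fin d))}

theorem integral_norm_sq_planeWave_mul_add
    {φ : EuclideanSpace ℝ (Fin d) → 𝕜} (hφ : MemLp φ 2 (volume.restrict Ω))
    (ξ : EuclideanSpace ℝ (Fin d)) :
    (∫ x in Ω, ‖(planeWave 0 ξ x : 𝕜) * φ x‖ ^ 2) +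
      ∫ x in Ω, ‖(planeWave (Real.pi / 2) ξ x : 𝕜) * φ x‖ ^ 2 = ∫ x in Ω, ‖φ x‖ ^ 2 := by
  have hm : ∀ θ, MemLp (fun x => (planeWave θ ξ x : 𝕜) * φ x) 2 (volume.restrict Ω) := fun θ =>
    memLp_planeWave_smul (𝕜 := 𝕜) hφ θ ξ
  rw [← integral_add ((hm _).integrable_norm_pow (by norm_num))
      ((hm _).integrable_norm_pow (by norm_num))]
  congr 1
  funext x
  rw [norm_mul, norm_mul, RCLike.norm_ofReal, RCLike.norm_ofReal, mul_pow, mul_pow, sq_abs,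
    sq_abs, ← add_mul, planeWave_sq_add_sq, one_mul]

/-- At each point the two gradients are a rotation of the pair `G x`, `2π φ(x) ξ`, by
`norm_sq_rotation`. Hence no cross term survives, even for complex `φ`, where a single complex
exponential would leave one. -/
theorem HasH10Gradient.integral_norm_sq_gradient_planeWave_mul_add (hb : Bornology.IsBounded Ω)
    {φ : EuclideanSpace ℝ (Fin d) → 𝕜}
    {G : EuclideanSpace ℝ (Fin d) → EuclideanSpace 𝕜 (Fin d)} (hφ : HasH10Gradient Ω φ G)
    (ξ : EuclideanSpace ℝ (Fin d)) :
    (∫ x in Ω, ‖(planeWave 0 ξ x : 𝕜) • G x +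
        (((2 * Real.pi : ℝ) : 𝕜) * ((planeWave (0 - Real.pi / 2) ξ x : 𝕜) * φ x)) •
          ofRealVector 𝕜 ξ‖ ^ 2) +
      (∫ x in Ω, ‖(planeWave (Real.pi / 2) ξ x : 𝕜) • G x +
        (((2 * Real.pi : ℝ) : 𝕜) * ((planeWave (Real.pi / 2 - Real.pi / 2) ξ x : 𝕜) * φ x)) •
          ofRealVector 𝕜 ξ‖ ^ 2) =
      (∫ x in Ω, ‖G x‖ ^ 2) + 4 * Real.pi ^ 2 * ‖ξ‖ ^ 2 * ∫ x in Ω, ‖φ x‖ ^ 2 := by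
  rw [← integral_add
      ((hφ.planeWave_mul hb 0 ξ).memLp_gradient.integrable_norm_pow (by norm_num))
      ((hφ.planeWave_mul hb (Real.pi / 2) ξ).memLp_gradient.integrable_norm_pow (by norm_num)),
    ← integral_const_mul, ← integral_add (hφ.memLp_gradient.integrable_norm_pow (by norm_num))
      ((hφ.memLp.integrable_norm_pow (by norm_num)).const_mul _)]
  congr 1
  funext x
  have h := norm_sq_rotation (𝕜 := 𝕜) (planeWave_sq_add_sq ξ x) (G x)
    ((((2 * Real.pi : ℝ) : 𝕜) * φ x) • ofRealVector 𝕜 ξ)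
  have hneg : planeWave (0 - Real.pi / 2) ξ x = -planeWave (Real.pi / 2) ξ x := by
    simp only [planeWave, ← sub_add, sub_zero, Real.cos_add_pi_div_two,
      Real.cos_sub_pi_div_two]
  have e1 : (planeWave 0 ξ x : 𝕜) • G x +
        (((2 * Real.pi : ℝ) : 𝕜) * ((planeWave (0 - Real.pi / 2) ξ x : 𝕜) * φ x)) •
          ofRealVector 𝕜 ξ = (planeWave 0 ξ x : 𝕜) • G x - (planeWave (Real.pi / 2) ξ x : 𝕜) •
            (((2 * Real.pi : ℝ) : 𝕜) * φ x) • ofRealVector 𝕜 ξ := by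
    rw [hneg, RCLike.ofReal_neg]
    module
  have e2 : (planeWave (Real.pi / 2) ξ x : 𝕜) • G x +
        (((2 * Real.pi : ℝ) : 𝕜) * ((planeWave (Real.pi / 2 - Real.pi / 2) ξ x : 𝕜) * φ x)) •
          ofRealVector 𝕜 ξ = (planeWave (Real.pi / 2) ξ x : 𝕜) • G x + (planeWave 0 ξ x : 𝕜) •
            (((2 * Real.pi : ℝ) : 𝕜) * φ x) • ofRealVector 𝕜 ξ := by
    rw [sub_self]
    module
  rw [e1, e2, h, norm_smul, norm_mul, RCLike.norm_ofReal, norm_ofRealVector,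
    abs_of_pos Real.two_pi_pos]
  ring

namespace IsDirichletEigenSequence

variable {lam : ℕ → ℝ} {u : ℕ → EuclideanSpace ℝ (Fin d) → 𝕜}

/-- The pivot of the argument: the same integrals are coefficients of `φ` times a wave along `u j`,
to be summed over `j` by Parseval, and wave coefficients of a product, to be integrated over `ξ` by
Plancherel. -/
theorem spectralDensity_mul_conj (hu : IsDirichletEigenSequence Ω lam u)
    {φ : EuclideanSpace ℝ (Fin d) → 𝕜} (hφ : MemLp φ 2 (volume.restrict Ω)) (j : ℕ)
    (ξ : EuclideanSpace ℝ (Fin d)) :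
    spectralDensity Ω (fun x => φ x * starRingEnd 𝕜 (u j x)) ξ =
      ‖inner 𝕜 (hu.uLp j) ((memLp_planeWave_smul (𝕜 := 𝕜) hφ 0 ξ).toLp _)‖ ^ 2 +
      ‖inner 𝕜 (hu.uLp j) ((memLp_planeWave_smul (𝕜 := 𝕜) hφ (Real.pi / 2) ξ).toLp _)‖ ^ 2 := by
  rw [hu.inner_uLp, hu.inner_uLp, spectralDensity, waveCoeff, waveCoeff]
  simp only [RCLike.inner_apply, smul_eq_mul, mul_assoc]

/-- The lower bound for the local heat content seen by the pair of coherent states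
`φ cos(2π⟪·, ξ⟫)`, `φ sin(2π⟪·, ξ⟫)`. -/
theorem mul_exp_le_tsum_spectralDensity (hu : IsDirichletEigenSequence Ω lam u) (hΩ : IsOpen Ω)
    (hb : Bornology.IsBounded Ω) {φ : EuclideanSpace ℝ (Fin d) → 𝕜}
    {G : EuclideanSpace ℝ (Fin d) → EuclideanSpace 𝕜 (Fin d)} (hφ : HasH10Gradient Ω φ G)
    (hP : 0 < ∫ x in Ω, ‖φ x‖ ^ 2) {t : ℝ} (ht : 0 < t) (ξ : EuclideanSpace ℝ (Fin d)) :
    (Summable fun j => Real.exp (-(lam j * t)) *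
        spectralDensity Ω (fun x => φ x * starRingEnd 𝕜 (u j x)) ξ) ∧
      (∫ x in Ω, ‖φ x‖ ^ 2) *
        Real.exp (-((∫ x in Ω, ‖G x‖ ^ 2) / (∫ x in Ω, ‖φ x‖ ^ 2) * t)) *
        Real.exp (-(4 * Real.pi ^ 2 * ‖ξ‖ ^ 2 * t)) ≤
      ∑' j, Real.exp (-(lam j * t)) *
        spectralDensity Ω (fun x => φ x * starRingEnd 𝕜 (u j x)) ξ := by
  set P := ∫ x in Ω, ‖φ x‖ ^ 2
  have hsum : HasSum (fun j => spectralDensity Ω (fun x => φ x * starRingEnd 𝕜 (u j x)) ξ) P := by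
    have h := (hu.hasSum_norm_sq_inner hΩ hb
      ((memLp_planeWave_smul (𝕜 := 𝕜) hφ.memLp 0 ξ).toLp _)).add (hu.hasSum_norm_sq_inner hΩ hb
      ((memLp_planeWave_smul (𝕜 := 𝕜) hφ.memLp (Real.pi / 2) ξ).toLp _))
    simp only [← hu.spectralDensity_mul_conj hφ.memLp] at h
    rw [norm_sq_toLp_eq_integral, norm_sq_toLp_eq_integral] at h
    simp only [smul_eq_mul] at h
    rwa [integral_norm_sq_planeWave_mul_add hφ.memLp] at h
  have hlam1 : ∀ j, Real.exp (-(lam j * t)) ≤ 1 := fun j => by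
    rw [Real.exp_le_one_iff, neg_nonpos]
    exact mul_nonneg (hu.eigenvalue_nonneg j) ht.le
  have hnn := fun j => spectralDensity_nonneg Ω (fun x => φ x * starRingEnd 𝕜 (u j x)) ξ
  have hs : Summable fun j => Real.exp (-(lam j * t)) *
      spectralDensity Ω (fun x => φ x * starRingEnd 𝕜 (u j x)) ξ :=
    hsum.summable.of_nonneg_of_le (fun j => mul_nonneg (Real.exp_pos _).le (hnn j))
      fun j => mul_le_of_le_one_left (hnn j) (hlam1 j)
  refine ⟨hs, ?_⟩
  have hD : ∀ s : Finset ℕ, ∑ j ∈ s, (1 + lam j) *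
      spectralDensity Ω (fun x => φ x * starRingEnd 𝕜 (u j x)) ξ ≤
      P + ((∫ x in Ω, ‖G x‖ ^ 2) + 4 * Real.pi ^ 2 * ‖ξ‖ ^ 2 * P) := by
    intro s
    have h0 := hu.sum_mul_norm_sq_inner_le (hφ.planeWave_mul hb 0 ξ) s
    have h1 := hu.sum_mul_norm_sq_inner_le (hφ.planeWave_mul hb (Real.pi / 2) ξ) s
    have e0 := integral_norm_sq_planeWave_mul_add hφ.memLp ξ
    have e1 := hφ.integral_norm_sq_gradient_planeWave_mul_add hb ξ
    simp only [hu.spectralDensity_mul_conj hφ.memLp, mul_add, Finset.sum_add_distrib]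
    simp only [smul_eq_mul]
    linarith
  -- The bound for the mean is `‖∇φ‖₂² / P + 4π²‖ξ‖²`, so its exponential splits off a Gaussian in
  -- `ξ`.
  have := mul_exp_le_tsum hP ht hu.eigenvalue_nonneg hnn hsum hD hs
  refine le_of_eq_of_le ?_ this
  rw [mul_assoc, ← Real.exp_add]
  congr 2
  field_simp
  ring

theorem memLp_mul_conj (hu : IsDirichletEigenSequence Ω lam u)
    {φ : EuclideanSpace ℝ (Fin d) → 𝕜} (hφ : MemLp φ ∞ (volume.restrict Ω)) (j : ℕ) :
    MemLp (fun x => φ x * starRingEnd 𝕜 (u j x)) 2 (volume.restrict Ω) :=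
  (hu.eigenfunction j).memLp.star.mul (p := ∞) (q := 2) hφ

theorem integral_norm_sq_mul_le (hu : IsDirichletEigenSequence Ω lam u)
    {φ : EuclideanSpace ℝ (Fin d) → 𝕜} (hφ : MemLp φ ∞ (volume.restrict Ω)) (j : ℕ) :
    ∫ x in Ω, ‖φ x * u j x‖ ^ 2 ≤ (eLpNorm φ ∞ (volume.restrict Ω)).toReal ^ 2 := by
  have hae : ∀ᵐ x ∂volume.restrict Ω, ‖φ x‖ ≤ (eLpNorm φ ∞ (volume.restrict Ω)).toReal := by
    rw [eLpNorm_exponent_top]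
    have hfin : eLpNormEssSup φ (volume.restrict Ω) ≠ ⊤ := by
      rw [← eLpNorm_exponent_top]; exact hφ.2.ne
    filter_upwards [enorm_ae_le_eLpNormEssSup φ (volume.restrict Ω)] with x hx
    rw [← toReal_enorm]
    exact ENNReal.toReal_mono hfin hx
  calc ∫ x in Ω, ‖φ x * u j x‖ ^ 2
      ≤ ∫ x in Ω, (eLpNorm φ ∞ (volume.restrict Ω)).toReal ^ 2 * ‖u j x‖ ^ 2 := by
        refine integral_mono_of_nonneg (Filter.Eventually.of_forall fun x => by positivity)
          (((hu.eigenfunction j).memLp.integrable_norm_pow (by norm_num)).const_mul _) ?_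
        filter_upwards [hae] with x hx
        rw [norm_mul, mul_pow]
        gcongr
    _ = _ := by rw [integral_const_mul, hu.integral_norm_sq_eq_one, mul_one]

end IsDirichletEigenSequence

/-- Integration of a pointwise lower bound for a series of nonnegative functions. -/
theorem integral_le_tsum_integral {α : Type*} [MeasurableSpace α] {μ : Measure α} {g : α → ℝ}
    {F : ℕ → α → ℝ} (hg : Integrable g μ) (hg0 : ∀ x, 0 ≤ g x) (hF : ∀ j, Integrable (F j) μ)
    (hF0 : ∀ j x, 0 ≤ F j x) (hle : ∀ x, Summable (fun j => F j x) ∧ g x ≤ ∑' j, F j x)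
    (hs : Summable fun j => ∫ x, F j x ∂μ) : ∫ x, g x ∂μ ≤ ∑' j, ∫ x, F j x ∂μ := by
  have hi0 : ∀ j, 0 ≤ ∫ x, F j x ∂μ := fun j => integral_nonneg (hF0 j)
  rw [← ENNReal.ofReal_le_ofReal_iff (tsum_nonneg hi0),
    ofReal_integral_eq_lintegral_ofReal hg (Filter.Eventually.of_forall hg0),
    ENNReal.ofReal_tsum_of_nonneg hi0 hs]
  -- All terms are nonnegative, so the exchange of sum and integral is Tonelli's theorem in `ℝ≥0∞`.
  calc ∫⁻ x, ENNReal.ofReal (g x) ∂μ ≤ ∫⁻ x, ∑' j, ENNReal.ofReal (F j x) ∂μ := by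
        refine lintegral_mono fun x => ?_
        rw [← ENNReal.ofReal_tsum_of_nonneg (fun j => hF0 j x) (hle x).1]
        exact ENNReal.ofReal_le_ofReal (hle x).2
    _ = ∑' j, ∫⁻ x, ENNReal.ofReal (F j x) ∂μ :=
        lintegral_tsum fun j => (hF j).1.aemeasurable.ennreal_ofReal
    _ = _ := by
        congr 1
        funext j
        rw [ofReal_integral_eq_lintegral_ofReal (hF j) (Filter.Eventually.of_forall (hF0 j))]

end Main

theorem mainTheorem11 {𝕜 : Type*} [RCLike 𝕜] {d : ℕ} (hd : 2 ≤ d)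
    (Ω : Set (EuclideanSpace ℝ (Fin d))) (hΩ_open : IsOpen Ω) (hΩ_conn : IsConnected Ω)
    (hΩ_bdd : Bornology.IsBounded Ω)
    (lam : ℕ → ℝ) (u : ℕ → EuclideanSpace ℝ (Fin d) → 𝕜)
    (hu : IsDirichletEigenSequence Ω lam u)
    (φ : EuclideanSpace ℝ (Fin d) → 𝕜)
    (gradφ : EuclideanSpace ℝ (Fin d) → EuclideanSpace 𝕜 (Fin d))
    (hφ : HasH10Gradient Ω φ gradφ) (hφ_bdd : MemLp φ ∞ (volume.restrict Ω))
    (hφ_ne : ¬ φ =ᵐ[volume.restrict Ω] 0)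
    (t : ℝ) (ht : 0 < t) :
    (Summable (fun j => Real.exp (-(lam j * t)) * ∫ x in Ω, ‖φ x * u j x‖ ^ 2) ∧
      (4 * Real.pi * t) ^ (-((d : ℝ) / 2)) * (∫ x in Ω, ‖φ x‖ ^ 2) *
          Real.exp (-((∫ x in Ω, ‖gradφ x‖ ^ 2) / (∫ x in Ω, ‖φ x‖ ^ 2) * t))
        ≤ ∑' j, Real.exp (-(lam j * t)) * ∫ x in Ω, ‖φ x * u j x‖ ^ 2) ∧
    (Summable (fun j => Real.exp (-(lam j * t))) ∧
      volume.real Ω / (4 * Real.pi * t) ^ ((d : ℝ) / 2) -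
          1 / (4 * Real.pi * t) ^ ((d : ℝ) / 2) *
            (((∫ x in Ω, ‖gradφ x‖ ^ 2) * t
                + volume.real Ω * (eLpNorm φ ∞ (volume.restrict Ω)).toReal ^ 2
                - ∫ x in Ω, ‖φ x‖ ^ 2) /
              (eLpNorm φ ∞ (volume.restrict Ω)).toReal ^ 2)
        ≤ ∑' j, Real.exp (-(lam j * t))) := by
  have hm := hΩ_open.measurableSet
  have hP : 0 < ∫ x in Ω, ‖φ x‖ ^ 2 := by
    rw [← norm_sq_toLp_eq_integral hφ.memLp]
    refine pow_pos (norm_pos_iff.2 fun h => hφ_ne ?_) 2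
    exact (hφ.memLp.coeFn_toLp).symm.trans ((Lp.eq_zero_iff_ae_eq_zero).1 h)
  have hM : 0 < (eLpNorm φ ∞ (volume.restrict Ω)).toReal :=
    ENNReal.toReal_pos (fun h => hφ_ne ((eLpNorm_eq_zero_iff hφ_bdd.1 (by simp)).1 h))
      hφ_bdd.2.ne
  have hsum := hu.summable_exp_neg hΩ_bdd hm ht
  have hle : ∀ j, Real.exp (-(lam j * t)) * ∫ x in Ω, ‖φ x * u j x‖ ^ 2 ≤
      Real.exp (-(lam j * t)) * (eLpNorm φ ∞ (volume.restrict Ω)).toReal ^ 2 := fun j =>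
    mul_le_mul_of_nonneg_left (hu.integral_norm_sq_mul_le hφ_bdd j) (Real.exp_pos _).le
  have hs1 : Summable (fun j => Real.exp (-(lam j * t)) * ∫ x in Ω, ‖φ x * u j x‖ ^ 2) :=
    (hsum.mul_right _).of_nonneg_of_le (fun j => mul_nonneg (Real.exp_pos _).le
      (integral_nonneg fun x => by positivity)) hle
  have hsd := fun j => spectralDensity_of_memLp hΩ_bdd hm (hu.memLp_mul_conj hφ_bdd j)
  have heq : ∀ j, ∫ ξ, Real.exp (-(lam j * t)) *
      spectralDensity Ω (fun x => φ x * starRingEnd 𝕜 (u j x)) ξ =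
      Real.exp (-(lam j * t)) * ∫ x in Ω, ‖φ x * u j x‖ ^ 2 := fun j => by
    rw [integral_const_mul, (hsd j).2]
    simp only [norm_mul, RCLike.norm_conj]
  obtain ⟨ig, eg⟩ := gaussian_integral_eq (d := d) ht
  have h1 : (4 * Real.pi * t) ^ (-((d : ℝ) / 2)) * (∫ x in Ω, ‖φ x‖ ^ 2) *
      Real.exp (-((∫ x in Ω, ‖gradφ x‖ ^ 2) / (∫ x in Ω, ‖φ x‖ ^ 2) * t)) ≤
      ∑' j, Real.exp (-(lam j * t)) * ∫ x in Ω, ‖φ x * u j x‖ ^ 2 := by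
    -- Integration over `ξ`: the Gaussian yields `(4πt)^(-d/2)` on the left, and Plancherel turns
    -- each density into `‖φ u_j‖₂²` on the right.
    have h := integral_le_tsum_integral (ig.const_mul ((∫ x in Ω, ‖φ x‖ ^ 2) *
        Real.exp (-((∫ x in Ω, ‖gradφ x‖ ^ 2) / (∫ x in Ω, ‖φ x‖ ^ 2) * t))))
      (fun ξ => by positivity) (fun j => (hsd j).1.const_mul (Real.exp (-(lam j * t))))
      (fun j ξ => mul_nonneg (Real.exp_pos _).le (spectralDensity_nonneg _ _ _))
      (hu.mul_exp_le_tsum_spectralDensity hΩ_open hΩ_bdd hφ hP ht)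
      (by simpa only [heq] using hs1)
    simp only [heq] at h
    rw [integral_const_mul, eg] at h
    refine le_of_eq_of_le ?_ h
    ring
  refine ⟨⟨hs1, h1⟩, hsum, ?_⟩
  have h2 : ∑' j, Real.exp (-(lam j * t)) * ∫ x in Ω, ‖φ x * u j x‖ ^ 2 ≤
      (∑' j, Real.exp (-(lam j * t))) * (eLpNorm φ ∞ (volume.restrict Ω)).toReal ^ 2 := by
    rw [← tsum_mul_right]
    exact hs1.tsum_le_tsum hle (hsum.mul_right _)
  have hc : 0 < (4 * Real.pi * t) ^ ((d : ℝ) / 2) := Real.rpow_pos_of_pos (by positivity) _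
  rw [Real.rpow_neg (by positivity)] at h1
  set c := (4 * Real.pi * t) ^ ((d : ℝ) / 2)
  set P := ∫ x in Ω, ‖φ x‖ ^ 2
  set D := ∫ x in Ω, ‖gradφ x‖ ^ 2
  set M := (eLpNorm φ ∞ (volume.restrict Ω)).toReal
  -- This is `1 - x ≤ exp(-x)` at `x = D t / P`. The second claim is then a rearrangement, its left
  -- side being `(P - D t) / (c M²)`.
  have h3 : c⁻¹ * (P - D * t) ≤ c⁻¹ * P * Real.exp (-(D / P * t)) := by
    rw [mul_assoc]
    gcongr
    have := mul_le_mul_of_nonneg_left (Real.add_one_le_exp (-(D / P * t))) hP.le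
    refine le_of_eq_of_le ?_ this
    field_simp
    ring
  have h4 := (h3.trans h1).trans h2
  rw [← div_le_iff₀ (by positivity)] at h4
  refine le_of_eq_of_le ?_ h4
  field_simp
  ring
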